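/- **Conventions.** Rings are commutative with unit. A simplicial complex $X$ is finite and is regarded as the poset of its faces, including the empty face $\emptyset$ of dimension $-1$; a face with $n$ vertices has dimension $n-1$, and $X(i)$ is the set of $i$-faces. $X$ is pure of dimension $d$ if every face lies in a $d$-face. A *proper weight function* on such an $X$ is a function $w:X\to(0,\infty)$ with $\sum_{y\in X(d)}w(y)=1$ and $w(x)=\sum_{y\in X(d),\,y\ge x} w(y)/\#\{x'\in X(i): x'\le y\}$ for every $i$ and $x\in X(i)$; write $w(A)=\sum_{a\in A}w(a)$. For $u\in X$ the link $X_u=\{x\in X: x\ge u\}$ is graded by $\dim_u x=\dim x-\dim u-1$ and carries the proper weight function $$w_u(x)=\frac{1}{\sum_{y\in X(d),\,y\ge u}w(y)}\sum_{y\in X(d),\,y\ge x}\frac{w(y)}{\#\{x'\in X(\dim x): u\le x'\le y\}} .$$ An *$R$-orientation* assigns to all faces $x<y$ with $\dim y=\dim x+1$ a unit $[y:x]\in R^\times$ such that $\sum_{x<y<z}[z:y][y:x]=0$ whenever $x\le z$ and $\dim z=\dim x+2$; links inherit it. An *$R$-sheaf* $\mathcal F$ on $X$ consists of $R$-modules $\mathcal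 F(x)$ $(x\in X)$ and $R$-linear maps $\mathrm{res}_{y\leftarrow x}:\mathcal F(x)\to\mathcal F(y)$ $(x\le y)$ with $\mathrm{res}_{x\leftarrow x}=\mathrm{id}$ and $\mathrm{res}_{z\leftarrow y}\mathrm{res}_{y\leftarrow x}=\mathrm{res}_{z\leftarrow x}$; $\mathcal F_u$ is its restriction to $X_u$. Put $C^i=\prod_{x\in X(i)}\mathcal F(x)$, $(df)(y)=\sum_{x\in X(i),\,x\le y}[y:x]\,\mathrm{res}_{y\leftarrow x}f(x)$ for $f\in C^i$ and $y\in X(i+1)$, $Z^i=\ker(d|_{C^i})$, $B^i=d(C^{i-1})$, $\|f\|_w=w(\{x\in X(i): f(x)\ne0\})$, $\mathrm{dist}_w(f,g)=\|f-g\|_w$ and $\mathrm{dist}_w(f,S)=\min_{g\in S}\|f-g\|_w$. Let $\mathrm{cse}_i(X,w,\mathcal F)$ (resp. $\mathrm{cbe}_i(X,w,\mathcal F)$) be the supremum in $[0,\infty]$ of all real $\mu\ge0$ such that $\|df\|_w\ge\mu\,\mathrm{dist}_w(f,Z^i)$ (resp. $\ge\mu\,\mathrm{dist}_w(f,B^i)$)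 for all $f\in C^i$, and let $\mathrm{ccd}_i(X,w,\mathcal F)=\inf\{\|f\|_w: f\in Z^i\setminus B^i\}\in[0,\infty]$. The same notions are used for links. The underlying weighted graph $\mathrm{ugr}(X_u,w_u)$, with vertices $X_u(0)$ and edges $X_u(1)$, is an *$(\alpha,\beta)$-skeleton expander* if $w_u(E(A))\le\alpha w_u(A)+\beta w_u(A)^2$ for every $A\subseteq X_u(0)$, where $E(A)$ is the set of edges with both vertices in $A$. For $g\in C^{k-\dim u-1}(X_u,\mathcal F_u)$ let $g^u\in C^k(X,\mathcal F)$ be its extension by zero. **Correction algorithm** (input $f\in C^k(X,\mathcal F)$ and $q\ge0$). Start with $f_0=f$. Given $f_i$, look for a face $u$ with $0\le\dim u\le k$ and $g\in C^{k-\dim u-1}(X_u,\mathcal F_u)$ such that $\|df_i+d(g^u)\|_w<\|df_i\|_w-q\,w(u)$. If there are none, return $f_i$; otherwise choose one such pair, set $f_{i+1}=f_i+g^u$ and repeat. **Theorem.** Let $k\ge0$ be an integer. There exist constants $K,K'\in(0,1]$, depending only on $k$, such that the following holds. Let $R$ be a commutative ring, let $X$ be a pure $d$-dimensional simplicial complex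 with $d\ge k+2$, with a proper weight function $w$ and an $R$-orientation, let $\mathcal F$ be an $R$-sheaf on $X$ and let $\varepsilon\in(0,1]$. Suppose that - (1a) $\mathrm{cbe}_{k-\dim u-1}(X_u,w_u,\mathcal F_u)\ge\varepsilon$ for every $u\in X(0)\cup\dots\cup X(k)$; - (1b) $\mathrm{cbe}_{k-\dim u}(X_u,w_u,\mathcal F_u)\ge\varepsilon$ for every $u\in X(0)\cup\dots\cup X(k+1)$; - (2) for every $u\in X(-1)\cup\dots\cup X(k)$, the graph $\mathrm{ugr}(X_u,w_u)$ is a $((K\varepsilon)^{2^{k-\dim u}},1)$-skeleton expander. Then $$\mathrm{cse}_k(X,w,\mathcal F)\ge K'(K\varepsilon)^{2^{k+2}-1}\qquad\text{and}\qquad \mathrm{ccd}_k(X,w,\mathcal F)\ge K'(K\varepsilon)^{2^{k+1}-1}.$$ Moreover, if $f\in C^k(X,\mathcal F)$ satisfies $\mathrm{dist}_w(f,Z^k)<K'(K\varepsilon)^{2^{k+2}-1}$, then the correction algorithm applied to $f$ with $q=K(K\varepsilon)^{2^{k+1}-1}$ stops and, whatever choices are made, returns some $f'\in Z^k$ with $\mathrm{dist}_w(f,f')\le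 K'^{-1}(K\varepsilon)^{-2^{k+1}}\,\mathrm{dist}_w(f,Z^k)$. -/

import Mathlib

universe u v t

namespace SheafExpansion

section Posets

/-- The dimension of a face of a graded poset (a finite poset graded by `ℤ`). -/
noncomputable abbrev dim {P : Type*} [PartialOrder P] [GradeOrder ℤ P] (x : P) : ℤ := grade ℤ x

/-- `X(i)`, the set of `i`-faces of a graded poset. -/
abbrev Cells (P : Type*) [PartialOrder P] [GradeOrder ℤ P] (i : ℤ) : Type _ :=
  {x : P // dim x = i}

/-- The link `X_u = {x | u ≤ x}`. -/
abbrev Link {P : Type*} [PartialOrder P] (u : P) : Type _ := {x : P // u ≤ x}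

open Classical in
noncomputable instance {P : Type*} [PartialOrder P] [Fintype P] (u : P) : Fintype (Link u) :=
  Subtype.fintype fun x => u ≤ x

/-- The link carries the dimension function `dim_u x = dim x - dim u - 1`. -/
noncomputable instance {P : Type*} [PartialOrder P] [GradeOrder ℤ P] (u : P) :
    GradeOrder ℤ (Link u) where
  grade x := dim x.1 - dim u - 1
  grade_strictMono := by
    intro a b h
    have h' : dim a.1 < dim b.1 := grade_strictMono (𝕆 := ℤ) (show a.1 < b.1 from h)
    show dim a.1 - dim u - 1 < dim b.1 - dim u - 1
    omega
  covBy_grade := by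
    intro a b h
    have hc : a.1 ⋖ b.1 := by
      refine ⟨h.1, fun c hac hcb => ?_⟩
      exact h.2 (c := ⟨c, a.2.trans hac.le⟩) hac hcb
    have h' : dim a.1 ⋖ dim b.1 := hc.grade ℤ
    rw [Order.covBy_iff_add_one_eq] at h' ⊢
    omega

theorem dim_link {P : Type*} [PartialOrder P] [GradeOrder ℤ P] {u : P} (x : Link u) :
    dim x = dim x.1 - dim u - 1 := rfl

/-- `P` is pure of dimension `d`: it is nonempty and each face lies below some `d`-face. -/
def IsPure (P : Type*) [PartialOrder P] [GradeOrder ℤ P] (d : ℕ) : Prop :=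
  Nonempty P ∧ ∀ x : P, ∃ y : P, dim y = d ∧ x ≤ y

open Classical in
/-- `w` is a proper weight function on the pure `d`-dimensional graded poset `P`. -/
structure IsProperWeight {P : Type*} [PartialOrder P] [GradeOrder ℤ P] [Fintype P]
    (d : ℕ) (w : P → ℝ) : Prop where
  pure : IsPure P d
  pos : ∀ x, 0 < w x
  sum_top : ∑ y : P with dim y = d, w y = 1
  weight_eq : ∀ x : P, w x =
    ∑ y : P with dim y = d ∧ x ≤ y,
      w y / (Finset.card {x' : P | dim x' = dim x ∧ x' ≤ y} : ℝ)

open Classical in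
/-- The proper weight function `w_u` induced on the link `X_u` by the proper weight function `w`
on the pure `d`-dimensional poset `X`. -/
noncomputable def linkWeight {P : Type*} [PartialOrder P] [GradeOrder ℤ P] [Fintype P]
    (d : ℕ) (w : P → ℝ) (u : P) (x : Link u) : ℝ :=
  (∑ y : P with dim y = d ∧ u ≤ y, w y)⁻¹ *
    ∑ y : P with dim y = d ∧ x.1 ≤ y,
      w y / (Finset.card {x' : P | dim x' = dim x.1 ∧ u ≤ x' ∧ x' ≤ y} : ℝ)

/-- `(ugr(P), w)`, whose vertices are the `0`-faces and whose edges are the `1`-faces of `P`, is an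
`(α, β)`-skeleton expander: `w(E(A)) ≤ α w(A) + β w(A)²` for each set `A` of vertices, where `E(A)`
consists of the edges that have two distinct vertices in `A`. -/
def IsSkeletonExpander {P : Type*} [PartialOrder P] [GradeOrder ℤ P] [Fintype P]
    (w : P → ℝ) (α β : ℝ) : Prop :=
  open Classical in
  ∀ A : Finset (Cells P 0),
    (∑ e : Cells P 1 with ∃ a ∈ A, ∃ b ∈ A, a ≠ b ∧ a.1 < e.1 ∧ b.1 < e.1, w e.1) ≤
      α * (∑ a ∈ A, w a.1) + β * (∑ a ∈ A, w a.1) ^ 2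

open Classical in
/-- An `R`-orientation `[y : x] = sgn y x ∈ Rˣ`. Only the values at pairs with `x ⋖ y` are
meaningful; the others do not enter anything below. -/
structure Orientation (R : Type*) [CommRing R] (P : Type*) [PartialOrder P] [GradeOrder ℤ P]
    [Fintype P] where
  sgn : P → P → Rˣ
  sum_eq_zero : ∀ x z : P, x ≤ z → dim z = dim x + 2 →
    ∑ y : P with x < y ∧ y < z, (sgn z y : R) * (sgn y x : R) = 0

/-- The orientation that a link inherits. -/
def Orientation.link {R : Type*} [CommRing R] {P : Type*} [PartialOrder P] [GradeOrder ℤ P]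
    [Fintype P] (o : Orientation R P) (u : P) : Orientation R (Link u) where
  sgn y x := o.sgn y.1 x.1
  sum_eq_zero x z hxz hdim := by
    classical
    have h : dim z.1 = dim x.1 + 2 := by
      rw [dim_link, dim_link] at hdim
      omega
    have key := o.sum_eq_zero x.1 z.1 hxz h
    rw [← key]
    refine Finset.sum_bij (fun y _ => y.1) ?_ ?_ ?_ ?_
    · intro y hy
      simp only [Finset.mem_filter, Finset.mem_univ, true_and] at hy ⊢
      exact hy
    · intro a _ b _ hab
      exact Subtype.ext hab
    · intro b hb
      simp only [Finset.mem_filter, Finset.mem_univ, true_and] at hb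
      refine ⟨⟨b, x.2.trans hb.1.le⟩, ?_, rfl⟩
      simp only [Finset.mem_filter, Finset.mem_univ, true_and]
      exact hb
    · intro a _
      rfl

end Posets

section Sheaves

/-- An `R`-sheaf on a poset: modules `obj x` with compatible restriction maps
`obj x → obj y` for `x ≤ y`. -/
structure PosetSheaf (R : Type u) [CommRing R] (P : Type v) [PartialOrder P] where
  obj : P → Type t
  [addCommGroup : ∀ x, AddCommGroup (obj x)]
  [module : ∀ x, Module R (obj x)]
  res : ∀ {x y : P}, x ≤ y → obj x →ₗ[R] obj y
  res_refl : ∀ x : P, res (le_refl x) = LinearMap.id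
  res_comp : ∀ {x y z : P} (hxy : x ≤ y) (hyz : y ≤ z), res hyz ∘ₗ res hxy = res (hxy.trans hyz)

attribute [instance] PosetSheaf.addCommGroup PosetSheaf.module

variable {R : Type u} [CommRing R] {P : Type v} [PartialOrder P]

/-- The restriction `F_u` of a sheaf to the link `X_u`. -/
def PosetSheaf.link (F : PosetSheaf.{u, v, t} R P) (u : P) : PosetSheaf.{u, v, t} R (Link u) where
  obj x := F.obj x.1
  res {x y} h := F.res (show x.1 ≤ y.1 from h)
  res_refl x := F.res_refl x.1
  res_comp {_ _ _} hxy hyz := F.res_comp hxy hyz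

variable [GradeOrder ℤ P]

/-- `C^i(X, F)`, the `i`-cochains. -/
abbrev Cochain (F : PosetSheaf.{u, v, t} R P) (i : ℤ) : Type _ := ∀ x : Cells P i, F.obj x.1

/-- The cochain `g^u` on `X` that extends by zero a cochain `g` on the link `X_u`. -/
noncomputable def extend (F : PosetSheaf.{u, v, t} R P) (u : P) (i : ℤ)
    (g : Cochain (F.link u) (i - dim u - 1)) : Cochain F i :=
  open Classical in
  fun x => if h : u ≤ x.1 then g ⟨⟨x.1, h⟩, by rw [dim_link, x.2]⟩ else 0

variable [Fintype P]

open Classical in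
/-- The coboundary map `(df)(y) = ∑_{x ∈ y(i)} [y : x] res_{y ← x} f(x)` from `C^i` to `C^j`.
It is only ever used with `j = i + 1`; having both indices free avoids casts. -/
noncomputable def coboundary (o : Orientation R P) (F : PosetSheaf.{u, v, t} R P) (i j : ℤ) :
    Cochain F i →ₗ[R] Cochain F j where
  toFun f y := ∑ x : Cells P i, if h : x.1 ≤ y.1 then (o.sgn y.1 x.1 : R) • F.res h (f x) else 0
  map_add' f g := by
    funext y
    simp only [Pi.add_apply]
    rw [← Finset.sum_add_distrib]
    refine Finset.sum_congr rfl fun x _ => ?_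
    split_ifs <;> simp
  map_smul' c f := by
    funext y
    simp only [Pi.smul_apply, RingHom.id_apply]
    rw [Finset.smul_sum]
    refine Finset.sum_congr rfl fun x _ => ?_
    split_ifs
    · rw [map_smul, smul_comm]
    · simp

/-- `Z^i = ker (d : C^i → C^{i+1})`. -/
noncomputable def cocycles (o : Orientation R P) (F : PosetSheaf.{u, v, t} R P) (i : ℤ) :
    Submodule R (Cochain F i) :=
  LinearMap.ker (coboundary o F i (i + 1))

/-- `B^i = im (d : C^{i-1} → C^i)`. -/
noncomputable def coboundaries (o : Orientation R P) (F : PosetSheaf.{u, v, t} R P) (i : ℤ) :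
    Submodule R (Cochain F i) :=
  LinearMap.range (coboundary o F (i - 1) i)

/-- `‖f‖_w = w(supp f)`. -/
noncomputable def wnorm (w : P → ℝ) {F : PosetSheaf.{u, v, t} R P} {i : ℤ} (f : Cochain F i) : ℝ :=
  open Classical in ∑ x : Cells P i with f x ≠ 0, w x.1

/-- `dist_w(f, S) = min_{g ∈ S} ‖f - g‖_w`. -/
noncomputable def wdist (w : P → ℝ) {F : PosetSheaf.{u, v, t} R P} {i : ℤ} (f : Cochain F i)
    (S : Submodule R (Cochain F i)) : ℝ :=
  ⨅ g : S, wnorm w (f - g.1)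

/-- The `i`-cosystolic expansion `cse_i(X, w, F)`, a supremum in `[0, ∞]`. -/
noncomputable def cse (o : Orientation R P) (w : P → ℝ) (F : PosetSheaf.{u, v, t} R P) (i : ℤ) :
    EReal :=
  sSup (Real.toEReal '' {μ : ℝ | 0 ≤ μ ∧ ∀ f : Cochain F i,
    μ * wdist w f (cocycles o F i) ≤ wnorm w (coboundary o F i (i + 1) f)})

/-- The `i`-coboundary expansion `cbe_i(X, w, F)`, a supremum in `[0, ∞]`. -/
noncomputable def cbe (o : Orientation R P) (w : P → ℝ) (F : PosetSheaf.{u, v, t} R P) (i : ℤ) :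
    EReal :=
  sSup (Real.toEReal '' {μ : ℝ | 0 ≤ μ ∧ ∀ f : Cochain F i,
    μ * wdist w f (coboundaries o F i) ≤ wnorm w (coboundary o F i (i + 1) f)})

/-- The `i`-cocycle distance `ccd_i(X, w, F)`, an infimum in `[0, ∞]` (it is `∞` if
`Z^i = B^i`). -/
noncomputable def ccd (o : Orientation R P) (w : P → ℝ) (F : PosetSheaf.{u, v, t} R P) (i : ℤ) :
    EReal :=
  sInf ((fun f : Cochain F i => Real.toEReal (wnorm w f)) ''
    {f | f ∈ cocycles o F i ∧ f ∉ coboundaries o F i})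

/-- `f'` is a possible successor of `f` in one round of the correction algorithm with
parameter `q`. -/
def CorrectionStep (o : Orientation R P) (w : P → ℝ) (F : PosetSheaf.{u, v, t} R P) (k : ℤ)
    (q : ℝ) (f f' : Cochain F k) : Prop :=
  ∃ u : P, 0 ≤ dim u ∧ dim u ≤ k ∧ ∃ g : Cochain (F.link u) (k - dim u - 1),
    wnorm w (coboundary o F k (k + 1) f + coboundary o F k (k + 1) (extend F u k g)) <
      wnorm w (coboundary o F k (k + 1) f) - q * w u ∧
    f' = f + extend F u k g

/-- The correction algorithm stops on the input `f`, however the choices are made: there is no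
infinite run. -/
def CorrectionStops (o : Orientation R P) (w : P → ℝ) (F : PosetSheaf.{u, v, t} R P) (k : ℤ)
    (q : ℝ) (f : Cochain F k) : Prop :=
  ¬ ∃ s : ℕ → Cochain F k, s 0 = f ∧ ∀ n, CorrectionStep o w F k q (s n) (s (n + 1))

/-- Some run of the correction algorithm on the input `f` returns `f'`. -/
def CorrectionReturns (o : Orientation R P) (w : P → ℝ) (F : PosetSheaf.{u, v, t} R P) (k : ℤ)
    (q : ℝ) (f f' : Cochain F k) : Prop :=
  Relation.ReflTransGen (CorrectionStep o w F k q) f f' ∧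
    ¬ ∃ f'', CorrectionStep o w F k q f' f''

end Sheaves

section Simplicial

/-- The poset of all faces of a simplicial complex, the empty face included. -/
abbrev FacePoset {V : Type v} (X : PreAbstractSimplicialComplex V) : Type v :=
  {s : Finset V // s = ∅ ∨ s ∈ X.faces}

/-- The dimension of a face is its number of vertices minus one. -/
instance {V : Type v} (X : PreAbstractSimplicialComplex V) : GradeOrder ℤ (FacePoset X) where
  grade s := (s.1.card : ℤ) - 1
  grade_strictMono := by
    intro a b h
    have h' : a.1.card < b.1.card := Finset.card_lt_card (show a.1 < b.1 from h)
    show (a.1.card : ℤ) - 1 < (b.1.card : ℤ) - 1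
    omega
  covBy_grade := by
    classical
    intro a b h
    have hlt : a.1 ⊂ b.1 := h.1
    obtain ⟨c, hcb, hca⟩ := Finset.exists_of_ssubset hlt
    have hface : b.1.erase c = ∅ ∨ b.1.erase c ∈ X.faces := by
      rcases Finset.eq_empty_or_nonempty (b.1.erase c) with h0 | h0
      · exact Or.inl h0
      · rcases b.2 with hb | hb
        · simp [hb] at hcb
        · exact Or.inr ((X.isRelLowerSet_faces hb).2 (Finset.erase_subset c b.1) h0)
    have hle : a.1 ⊆ b.1.erase c := Finset.subset_erase.2 ⟨hlt.1, hca⟩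
    have heq : a.1 = b.1.erase c := by
      by_contra hne
      exact h.2 (c := ⟨b.1.erase c, hface⟩)
        (show a.1 < b.1.erase c from lt_of_le_of_ne hle hne)
        (show b.1.erase c < b.1 from Finset.erase_ssubset hcb)
    have hcard := Finset.card_erase_add_one hcb
    rw [← heq] at hcard
    rw [Order.covBy_iff_add_one_eq]
    omega

end Simplicial

end SheafExpansion

/-! Everything rests on one vanishing statement, `eq_zero_of_locally_minimal`: a cocycle g on faces
with N vertices is zero if its norm G is small and if adding b^u, for a coboundary b on the link of
a nonempty face u, never lowers the norm by more than q w(u).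

Put δ = Kε and let S be the support of g. Fatness is propagated downwards: members of S are fat of
codimension 0, and z is fat of codimension r + 1 if the fat faces of codimension r above it weigh at
least δ^(2^r) w(z). Double counting bounds the weight of the fat faces of codimension r by a
constant times δ^(-(2^r - 1)) G, so for small G the empty face, of weight 1, is not fat. Descending
through fat faces from any x in S therefore ends at a nonempty terminal face u. This covers g by
pieces H_u, the restrictions of g to the x that reach u.

A face y with N + 1 vertices is bad if some face of y contains, as facets, two distinct fat faces
whose intersection is not fat. Below a good y fatness survives such intersections, so a terminal u
reached from one member of S below y is reached from all of them (`Reach.of_terminal`), and dH_u(y)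
= dg(y) = 0. Hence dH_u lives on bad faces above u, and coboundary expansion of the link together
with local minimality gives ε(‖H_u‖ - q w(u)) ≤ w(bad faces above u) (`local_expansion`). Bad faces
are rare: in the link of a non-fat z the fat vertices have small weight, so skeleton expansion
leaves few edges between them, and in total w(bad) = O(δG) (`weight_bad_le`). Summing over u gives
εG ≤ O(K)εG, which forces G = 0 for small K.

For cosystolic expansion and the algorithm, the statement is applied to df', where f' is an output:
a local coboundary extends to some d(h^u), so halting is local minimality of df'. Each step pays q
w(u) in ‖df‖ for a move of size O(w(u)), which controls the distance from f to f'. For the cocycle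
distance it is applied with q = 0 to a lightest representative of a class. -/

namespace SheafExpansion

/-! ### Double counting for proper weights -/

section Weights

variable {V : Type v} {X : PreAbstractSimplicialComplex V}

theorem dim_face (x : FacePoset X) : dim x = (x.1.card : ℤ) - 1 := rfl

theorem face_le_iff {x y : FacePoset X} : x ≤ y ↔ x.1 ⊆ y.1 := Iff.rfl

theorem face_card_le {x y : FacePoset X} (h : x ≤ y) : x.1.card ≤ y.1.card :=
  Finset.card_le_card h

theorem eq_of_le_of_card {x y : FacePoset X} (h : x ≤ y) (hc : y.1.card ≤ x.1.card) : x = y :=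
  Subtype.ext (Finset.eq_of_subset_of_card_le h hc)

theorem isFace_of_subset {s : Finset V} (y : FacePoset X) (h : s ⊆ y.1) :
    s = ∅ ∨ s ∈ X.faces := by
  rcases Finset.eq_empty_or_nonempty s with h0 | h0
  · exact Or.inl h0
  · rcases y.2 with hy | hy
    · rw [hy] at h
      exact Or.inl (Finset.subset_empty.1 h)
    · exact Or.inr ((X.isRelLowerSet_faces hy).2 h h0)

open Classical in
/-- The intersection of two faces. -/
noncomputable def faceInter (x y : FacePoset X) : FacePoset X :=
  ⟨x.1 ∩ y.1, isFace_of_subset x Finset.inter_subset_left⟩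

theorem faceInter_le_left (x y : FacePoset X) : faceInter x y ≤ x := by
  classical exact Finset.inter_subset_left

theorem faceInter_le_right (x y : FacePoset X) : faceInter x y ≤ y := by
  classical exact Finset.inter_subset_right

theorem le_faceInter {z x y : FacePoset X} (hx : z ≤ x) (hy : z ≤ y) : z ≤ faceInter x y := by
  classical exact Finset.subset_inter hx hy

theorem faceInter_card_add_one {a b c : FacePoset X} (hab : a ≠ b) (hac : a ≤ c) (hbc : b ≤ c)
    (h : a.1.card = b.1.card) (hc : c.1.card = a.1.card + 1) :
    (faceInter a b).1.card + 1 = a.1.card := by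
  classical
  have h1 : (a.1 ∪ b.1).card ≤ c.1.card := Finset.card_le_card (Finset.union_subset hac hbc)
  have h2 : (a.1 ∪ b.1).card + (a.1 ∩ b.1).card = a.1.card + b.1.card :=
    Finset.card_union_add_card_inter _ _
  have h3 : (a.1 ∩ b.1).card < a.1.card := by
    refine Finset.card_lt_card (Finset.ssubset_iff_subset_ne.2 ⟨Finset.inter_subset_left, ?_⟩)
    intro he
    exact hab (eq_of_le_of_card (Finset.inter_eq_left.1 he) h.ge)
  show (a.1 ∩ b.1).card + 1 = _
  omega

variable [Fintype (FacePoset X)]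

open Classical in
theorem card_faces_between {u y : FacePoset X} (h : u ≤ y) {j : ℕ} (hj : u.1.card ≤ j) :
    Finset.card {x : FacePoset X | x.1.card = j ∧ u ≤ x ∧ x ≤ y} =
      (y.1.card - u.1.card).choose (j - u.1.card) := by
  rw [← Finset.card_sdiff_of_subset h, ← Finset.card_powersetCard]
  refine Finset.card_bij (fun x _ => x.1 \ u.1) ?_ ?_ ?_
  · intro x hx
    simp only [Finset.mem_filter, Finset.mem_univ, true_and] at hx
    rw [Finset.mem_powersetCard]
    refine ⟨Finset.sdiff_subset_sdiff hx.2.2 le_rfl, ?_⟩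
    rw [Finset.card_sdiff_of_subset hx.2.1, hx.1]
  · intro x hx x' hx' he
    simp only [Finset.mem_filter, Finset.mem_univ, true_and] at hx hx'
    refine Subtype.ext ?_
    rw [← Finset.sdiff_union_of_subset hx.2.1, ← Finset.sdiff_union_of_subset hx'.2.1, he]
  · intro s hs
    rw [Finset.mem_powersetCard] at hs
    have hsy : s ∪ u.1 ⊆ y.1 := Finset.union_subset (hs.1.trans Finset.sdiff_subset) h
    have hd : Disjoint s u.1 := Finset.disjoint_of_subset_left hs.1 Finset.sdiff_disjoint
    refine ⟨⟨s ∪ u.1, isFace_of_subset y hsy⟩, ?_, ?_⟩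
    · simp only [Finset.mem_filter, Finset.mem_univ, true_and]
      refine ⟨?_, Finset.subset_union_right, hsy⟩
      rw [Finset.card_union_of_disjoint hd, hs.2]
      omega
    · exact Finset.union_sdiff_cancel_right hd

open Classical in
theorem card_faces_below_le (y : FacePoset X) :
    Finset.card {x : FacePoset X | x ≤ y} ≤ 2 ^ y.1.card := by
  rw [← Finset.card_powerset]
  refine Finset.card_le_card_of_injOn (fun x => x.1) ?_ ?_
  · intro x hx
    simp only [Finset.coe_filter, Finset.mem_univ, true_and, Set.mem_ofPred_eq] at hx
    simpa using face_le_iff.1 hx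
  · intro x _ x' _ h
    exact Subtype.ext h

open Classical in
theorem card_faces_eq (y : FacePoset X) (j : ℕ) :
    Finset.card {x : FacePoset X | x.1.card = j ∧ x ≤ y} = y.1.card.choose j := by
  have h := card_faces_between (X := X) (u := ⟨∅, Or.inl rfl⟩) (y := y)
    (Finset.empty_subset _) (j := j) (by simp)
  simp only [Finset.card_empty, Nat.sub_zero] at h
  rw [← h]
  refine congrArg Finset.card (Finset.filter_congr fun x _ => ?_)
  have h0 : (⟨∅, Or.inl rfl⟩ : FacePoset X) ≤ x := Finset.empty_subset x.1
  tauto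

variable {d : ℕ} {w : FacePoset X → ℝ}

open Classical in
/-- The total weight of the top faces that contain `x`. -/
noncomputable def topWeight (d : ℕ) (w : FacePoset X → ℝ) (x : FacePoset X) : ℝ :=
  ∑ y : FacePoset X with dim y = d ∧ x ≤ y, w y

theorem IsProperWeight.card_le (hw : IsProperWeight d w) (x : FacePoset X) :
    x.1.card ≤ d + 1 := by
  obtain ⟨y, hy, hxy⟩ := hw.pure.2 x
  rw [dim_face] at hy
  have := face_card_le hxy
  omega

/-- All top faces have equally many faces of a given size, so the denominators in `weight_eq` are
one binomial coefficient. -/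
theorem IsProperWeight.mul_choose (hw : IsProperWeight d w) (x : FacePoset X) :
    w x * ((d + 1).choose x.1.card : ℝ) = topWeight d w x := by
  classical
  have hpos : (0 : ℝ) < (d + 1).choose x.1.card :=
    Nat.cast_pos.2 (Nat.choose_pos (hw.card_le x))
  rw [← eq_div_iff hpos.ne', hw.weight_eq x, topWeight, Finset.sum_div]
  refine Finset.sum_congr (by ext; simp) fun y hy => ?_
  simp only [Finset.mem_filter, Finset.mem_univ, true_and] at hy
  have hc : y.1.card = d + 1 := by
    have := hy.1
    rw [dim_face] at this
    omega
  rw [← hc, ← card_faces_eq]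
  congr 3
  ext x'
  simp [dim_face]

theorem choose_link_identity {a j m : ℕ} (ha : a ≤ j) :
    (m.choose j : ℝ) * j.choose a = m.choose a * (m - a).choose (j - a) := by
  exact_mod_cast Nat.choose_mul ha

open Classical in
-- After expanding into top faces z and exchanging sums, each z above x is counted once for every
-- face with j vertices between x and z.
theorem IsProperWeight.sum_above (hw : IsProperWeight d w) (x : FacePoset X) {j : ℕ}
    (hxj : x.1.card ≤ j) (hj : j ≤ d + 1) :
    ∑ y : FacePoset X with y.1.card = j ∧ x ≤ y, w y = j.choose x.1.card * w x := by
  have hpos : (0 : ℝ) < (d + 1).choose j := Nat.cast_pos.2 (Nat.choose_pos hj)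
  have hpos' : (0 : ℝ) < (d + 1).choose x.1.card :=
    Nat.cast_pos.2 (Nat.choose_pos (hw.card_le x))
  have key : (∑ y : FacePoset X with y.1.card = j ∧ x ≤ y, w y) * (d + 1).choose j =
      topWeight d w x * (d + 1 - x.1.card).choose (j - x.1.card) := by
    rw [Finset.sum_mul]
    have h1 : ∀ y ∈ (Finset.univ.filter fun y : FacePoset X => y.1.card = j ∧ x ≤ y),
        w y * (d + 1).choose j = ∑ z : FacePoset X with dim z = d ∧ y ≤ z, w z := by
      intro y hy
      simp only [Finset.mem_filter, Finset.mem_univ, true_and] at hy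
      rw [← hy.1, hw.mul_choose y]
      rfl
    rw [Finset.sum_congr rfl h1, topWeight, Finset.sum_mul,
      Finset.sum_comm' (t' := Finset.univ.filter fun z : FacePoset X => dim z = d ∧ x ≤ z)
        (s' := fun z => Finset.univ.filter fun y : FacePoset X => y.1.card = j ∧ x ≤ y ∧ y ≤ z)]
    · refine Finset.sum_congr rfl fun z hz => ?_
      simp only [Finset.mem_filter, Finset.mem_univ, true_and] at hz
      have hc : z.1.card = d + 1 := by
        have := hz.1
        rw [dim_face] at this
        omega
      rw [Finset.sum_const, nsmul_eq_mul, card_faces_between hz.2 hxj, hc, mul_comm]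
    · intro y z
      simp only [Finset.mem_filter, Finset.mem_univ, true_and]
      constructor
      · rintro ⟨⟨h1, h2⟩, h3, h4⟩
        exact ⟨⟨h1, h2, h4⟩, h3, h2.trans h4⟩
      · rintro ⟨⟨h1, h2, h4⟩, h3, -⟩
        exact ⟨⟨h1, h2⟩, h3, h4⟩
  have hid := choose_link_identity (m := d + 1) hxj
  rw [← hw.mul_choose x, mul_assoc, ← hid] at key
  have : ((∑ y : FacePoset X with y.1.card = j ∧ x ≤ y, w y)) * (d + 1).choose j =
      (j.choose x.1.card * w x) * (d + 1).choose j := by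
    rw [key]; ring
  exact mul_right_cancel₀ hpos.ne' this

/-- This is the exchange rate between weights in the link and in the whole complex; the top weights
cancel by `choose_link_identity`. -/
theorem IsProperWeight.linkWeight_mul (hw : IsProperWeight d w) (u : FacePoset X) (x : Link u) :
    (w u * x.1.1.card.choose u.1.card) * linkWeight d w u x = w x.1 := by
  classical
  have hux : u.1.card ≤ x.1.1.card := face_card_le x.2
  have hx := hw.card_le x.1
  have h1 : linkWeight d w u x = (topWeight d w u)⁻¹ *
      (topWeight d w x.1 / (d + 1 - u.1.card).choose (x.1.1.card - u.1.card)) := by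
    unfold linkWeight topWeight
    rw [Finset.sum_div]
    congr 1
    · congr 1
      exact Finset.sum_congr (by ext; simp) fun _ _ => rfl
    · refine Finset.sum_congr (by ext; simp) fun y hy => ?_
      simp only [Finset.mem_filter, Finset.mem_univ, true_and] at hy
      have hc : y.1.card = d + 1 := by
        have := hy.1
        rw [dim_face] at this
        omega
      rw [← hc, ← card_faces_between (x.2.trans hy.2) hux]
      congr 3
      ext x'
      simp [dim_face]
  have hu0 : (0 : ℝ) < (d + 1).choose u.1.card := Nat.cast_pos.2 (Nat.choose_pos (hw.card_le u))
  have hc0 : (0 : ℝ) < (d + 1 - u.1.card).choose (x.1.1.card - u.1.card) :=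
    Nat.cast_pos.2 (Nat.choose_pos (by omega))
  have hid := choose_link_identity (m := d + 1) hux
  have hwu := hw.pos u
  rw [h1, ← hw.mul_choose u, ← hw.mul_choose x.1]
  field_simp
  linear_combination w x.1 * hid

theorem IsProperWeight.weight_bot (hw : IsProperWeight d w) {x : FacePoset X}
    (hx : x.1.card = 0) : w x = 1 := by
  classical
  have h := hw.mul_choose x
  rw [hx, Nat.choose_zero_right, Nat.cast_one, mul_one] at h
  rw [h, ← hw.sum_top, topWeight]
  refine Finset.sum_congr ?_ fun _ _ => rfl
  ext y
  simp [face_le_iff, Finset.card_eq_zero.1 hx]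

end Weights

/-! ### Fat faces, descending chains and bad faces -/

section Fat

theorem sum_biUnion_le_sum {ι α : Type*} [DecidableEq α] {f : α → ℝ} (hf : ∀ x, 0 ≤ f x)
    (s : Finset ι) (t : ι → Finset α) :
    ∑ x ∈ s.biUnion t, f x ≤ ∑ i ∈ s, ∑ x ∈ t i, f x := by
  classical
  induction s using Finset.induction_on with
  | empty => simp
  | insert i s hi ih =>
    rw [Finset.biUnion_insert, Finset.sum_insert hi]
    have h1 := Finset.sum_union_inter (s₁ := t i) (s₂ := s.biUnion t) (f := f)
    have h2 : 0 ≤ ∑ x ∈ t i ∩ s.biUnion t, f x := Finset.sum_nonneg fun x _ => hf x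
    linarith

variable {V : Type v} {X : PreAbstractSimplicialComplex V} [Fintype (FacePoset X)]
  {d : ℕ} {w : FacePoset X → ℝ} {δ : ℝ} {N : ℕ} {S : Finset (FacePoset X)}

open Classical in
/-- The fat faces of codimension `r` over a set `S` of faces with `N` vertices. -/
noncomputable def fat (w : FacePoset X → ℝ) (δ : ℝ) (N : ℕ) (S : Finset (FacePoset X)) :
    ℕ → Finset (FacePoset X)
  | 0 => S
  | r + 1 => {z : FacePoset X | z.1.card + (r + 1) = N ∧
      δ ^ 2 ^ r * w z ≤ ∑ x ∈ fat w δ N S r with z ≤ x, w x}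

/-- `u` is reached from `x ∈ S` along a descending chain of fat faces of length `r`. -/
def Reach (w : FacePoset X → ℝ) (δ : ℝ) (N : ℕ) (S : Finset (FacePoset X)) :
    ℕ → FacePoset X → FacePoset X → Prop
  | 0, u, x => u = x ∧ x ∈ S
  | r + 1, u, x => u ∈ fat w δ N S (r + 1) ∧ ∃ v, u ≤ v ∧ Reach w δ N S r v x

/-- `b` contains two different fat faces of codimension `r`, both of them over the face `z`,
which is not fat. -/
def IsBadPair (w : FacePoset X → ℝ) (δ : ℝ) (N : ℕ) (S : Finset (FacePoset X)) (r : ℕ)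
    (z b : FacePoset X) : Prop :=
  b.1.card + r = N + 1 ∧ ∃ a ∈ fat w δ N S r, ∃ a' ∈ fat w δ N S r,
    a ≠ a' ∧ z ≤ a ∧ z ≤ a' ∧ a ≤ b ∧ a' ≤ b

/-- `y` contains two fat faces of the same dimension that meet in a face of one dimension less
which is not fat. -/
def IsBad (w : FacePoset X → ℝ) (δ : ℝ) (N : ℕ) (S : Finset (FacePoset X))
    (y : FacePoset X) : Prop :=
  ∃ r z b, z.1.card + (r + 1) = N ∧ z ∉ fat w δ N S (r + 1) ∧ IsBadPair w δ N S r z b ∧ b ≤ y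

theorem fat_card (hS : ∀ x ∈ S, x.1.card = N) {r : ℕ} {x : FacePoset X}
    (hx : x ∈ fat w δ N S r) : x.1.card + r = N := by
  classical
  cases r with
  | zero => exact hS x hx
  | succ r =>
    simp only [fat, Finset.mem_filter, Finset.mem_univ, true_and] at hx
    exact hx.1

theorem Reach.mem_fat {r : ℕ} {u x : FacePoset X} (h : Reach w δ N S r u x) :
    u ∈ fat w δ N S r := by
  cases r with
  | zero => rw [h.1]; exact h.2
  | succ r => exact h.1

theorem Reach.le {r : ℕ} {u x : FacePoset X} (h : Reach w δ N S r u x) : u ≤ x := by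
  induction r generalizing u with
  | zero => exact h.1.le
  | succ r ih => obtain ⟨-, v, huv, hv⟩ := h; exact huv.trans (ih hv)

theorem faceInter_mem_fat (hS : ∀ x ∈ S, x.1.card = N) {y : FacePoset X}
    (hy : ¬ IsBad w δ N S y) {r : ℕ} {a a' b : FacePoset X} (ha : a ∈ fat w δ N S r)
    (ha' : a' ∈ fat w δ N S r) (hne : a ≠ a') (hab : a ≤ b) (hab' : a' ≤ b)
    (hb : b.1.card + r = N + 1) (hby : b ≤ y) : faceInter a a' ∈ fat w δ N S (r + 1) := by
  by_contra hz
  have h1 := fat_card hS ha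
  have h2 := fat_card hS ha'
  have h3 := faceInter_card_add_one hne hab hab' (by omega) (by omega)
  exact hy ⟨r, faceInter a a', b, by omega, hz, ⟨hb, a, ha, a', ha', hne, faceInter_le_left _ _,
    faceInter_le_right _ _, hab, hab'⟩, hby⟩

/-- Induction along the chain from x to u: intersecting each of its members with x' gives a chain
that starts at x', and goodness of y keeps the new faces fat as long as they differ from the old
ones. -/
theorem Reach.swap (hS : ∀ x ∈ S, x.1.card = N) {y : FacePoset X} (hyc : y.1.card = N + 1)
    (hy : ¬ IsBad w δ N S y) {r : ℕ} {u x x' : FacePoset X} (h : Reach w δ N S r u x)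
    (hx : x ≤ y) (hx'S : x' ∈ S) (hx' : x' ≤ y) :
    (u ≤ x' ∧ Reach w δ N S r u x') ∨ Reach w δ N S (r + 1) (faceInter u x') x' := by
  induction r generalizing u with
  | zero =>
    obtain ⟨rfl, hxS⟩ := h
    by_cases hne : u = x'
    · subst hne
      exact Or.inl ⟨le_rfl, rfl, hxS⟩
    · exact Or.inr ⟨faceInter_mem_fat hS hy (r := 0) hxS hx'S hne hx hx' (by omega) le_rfl,
        x', faceInter_le_right _ _, rfl, hx'S⟩
  | succ r ih =>
    obtain ⟨hu, v, huv, hv⟩ := h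
    rcases ih hv with ⟨hvx, hr⟩ | hr
    · exact Or.inl ⟨huv.trans hvx, hu, v, huv, hr⟩
    · have h1 := fat_card hS hu
      have h2 := fat_card hS hr.mem_fat
      have h3 := fat_card hS hv.mem_fat
      by_cases hux : u ≤ x'
      · have he : u = faceInter v x' := eq_of_le_of_card (le_faceInter huv hux) (by omega)
        rw [← he] at hr
        exact Or.inl ⟨hux, hr⟩
      · right
        -- These are two distinct fat faces of codimension r + 1 inside `v`, which has one vertex
        -- more, so their intersection is fat.
        have hne : u ≠ faceInter v x' := fun he => hux (he ▸ faceInter_le_right v x')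
        have hm := faceInter_mem_fat hS hy hu hr.mem_fat hne huv (faceInter_le_left v x')
          (by omega) (hv.le.trans hx)
        have he : faceInter u (faceInter v x') = faceInter u x' :=
          le_antisymm
            (le_faceInter (faceInter_le_left _ _)
              ((faceInter_le_right _ _).trans (faceInter_le_right _ _)))
            (le_faceInter (faceInter_le_left _ _)
              (le_faceInter ((faceInter_le_left _ _).trans huv) (faceInter_le_right _ _)))
        rw [he] at hm
        refine ⟨hm, faceInter v x', le_faceInter ((faceInter_le_left _ _).trans huv)
          (faceInter_le_right _ _), hr⟩

open Classical in
/-- The fat faces of codimension `r` that contain no fat face of codimension `r + 1`. -/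
noncomputable def terminal (w : FacePoset X → ℝ) (δ : ℝ) (N : ℕ) (S : Finset (FacePoset X))
    (r : ℕ) : Finset (FacePoset X) :=
  {u ∈ fat w δ N S r | ∀ v ∈ fat w δ N S (r + 1), ¬ v ≤ u}

/-- Otherwise the chain could be prolonged forever, while a fat face of codimension r has N - r
vertices. -/
theorem exists_reach_terminal (hS : ∀ x ∈ S, x.1.card = N) {x : FacePoset X} (hx : x ∈ S) :
    ∃ r u, u ∈ terminal w δ N S r ∧ Reach w δ N S r u x := by
  classical
  by_contra! hcon
  have key : ∀ r, ∃ u, Reach w δ N S r u x := by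
    intro r
    induction r with
    | zero => exact ⟨x, rfl, hx⟩
    | succ r ih =>
      obtain ⟨u, hu⟩ := ih
      have hnt : u ∉ terminal w δ N S r := fun h => hcon r u h hu
      simp only [terminal, Finset.mem_filter, not_and] at hnt
      have := hnt hu.mem_fat
      push Not at this
      obtain ⟨v, hv, hvu⟩ := this
      exact ⟨v, hv, u, hvu, hu⟩
  obtain ⟨u, hu⟩ := key (N + 1)
  have := fat_card hS hu.mem_fat
  omega

/-- The other alternative of `Reach.swap` would put a fat face of codimension r + 1 below `u`. -/
theorem Reach.of_terminal (hS : ∀ x ∈ S, x.1.card = N) {y : FacePoset X}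
    (hyc : y.1.card = N + 1) (hy : ¬ IsBad w δ N S y) {r : ℕ} {u x x' : FacePoset X}
    (hu : u ∈ terminal w δ N S r) (h : Reach w δ N S r u x) (hx : x ≤ y) (hx'S : x' ∈ S)
    (hx' : x' ≤ y) : Reach w δ N S r u x' := by
  classical
  rcases h.swap hS hyc hy hx hx'S hx' with h1 | h1
  · exact h1.2
  · simp only [terminal, Finset.mem_filter] at hu
    exact absurd (faceInter_le_left u x') (hu.2 _ h1.mem_fat)

open Classical in
-- Each x is counted once per member of `B` below it, and it has at most 2^m faces.
theorem sum_sum_above_le (hw0 : ∀ x, 0 ≤ w x) (A B : Finset (FacePoset X)) {m : ℕ}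
    (hA : ∀ x ∈ A, x.1.card ≤ m) :
    ∑ z ∈ B, ∑ x ∈ A with z ≤ x, w x ≤ 2 ^ m * ∑ x ∈ A, w x := by
  rw [Finset.sum_comm' (t' := A) (s' := fun x => B.filter fun z => z ≤ x ∧ x ∈ A)]
  · rw [Finset.mul_sum]
    refine Finset.sum_le_sum fun x hx => ?_
    rw [Finset.sum_const, nsmul_eq_mul]
    refine mul_le_mul_of_nonneg_right ?_ (hw0 x)
    have h1 : (B.filter fun z => z ≤ x ∧ x ∈ A).card ≤
        Finset.card {z : FacePoset X | z ≤ x} := by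
      refine Finset.card_le_card fun z hz => ?_
      simp only [Finset.mem_filter, Finset.mem_univ, true_and] at hz ⊢
      exact hz.2.1
    have h2 : 2 ^ x.1.card ≤ 2 ^ m := Nat.pow_le_pow_right (by norm_num) (hA x hx)
    exact_mod_cast h1.trans ((card_faces_below_le x).trans h2)
  · intro z x
    simp only [Finset.mem_filter]
    tauto

theorem weight_fat_succ_le (hw0 : ∀ x, 0 ≤ w x) (hS : ∀ x ∈ S, x.1.card = N) (r : ℕ) :
    δ ^ 2 ^ r * ∑ z ∈ fat w δ N S (r + 1), w z ≤ 2 ^ N * ∑ x ∈ fat w δ N S r, w x := by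
  classical
  refine le_trans ?_ (sum_sum_above_le hw0 (fat w δ N S r) (fat w δ N S (r + 1)) fun x hx => ?_)
  · rw [Finset.mul_sum]
    refine Finset.sum_le_sum fun z hz => ?_
    simp only [fat, Finset.mem_filter, Finset.mem_univ, true_and] at hz
    exact hz.2
  · have := fat_card hS hx
    omega

/-- The thresholds multiply up, with 1 + 2 + ... + 2^(r-1) = 2^r - 1; this is the source of the
exponents in the theorem. -/
theorem weight_fat_le (hw0 : ∀ x, 0 ≤ w x) (hδ : 0 ≤ δ) (hS : ∀ x ∈ S, x.1.card = N) (r : ℕ) :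
    δ ^ (2 ^ r - 1) * ∑ z ∈ fat w δ N S r, w z ≤ (2 ^ N) ^ r * ∑ x ∈ S, w x := by
  induction r with
  | zero => simp [fat]
  | succ r ih =>
    have hp : 1 ≤ 2 ^ r := Nat.one_le_two_pow
    have he : 2 ^ (r + 1) - 1 = (2 ^ r - 1) + 2 ^ r := by
      rw [pow_succ]; omega
    calc δ ^ (2 ^ (r + 1) - 1) * ∑ z ∈ fat w δ N S (r + 1), w z
        = δ ^ (2 ^ r - 1) * (δ ^ 2 ^ r * ∑ z ∈ fat w δ N S (r + 1), w z) := by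
          rw [he, pow_add, mul_assoc]
      _ ≤ δ ^ (2 ^ r - 1) * (2 ^ N * ∑ x ∈ fat w δ N S r, w x) :=
          mul_le_mul_of_nonneg_left (weight_fat_succ_le hw0 hS r) (by positivity)
      _ = 2 ^ N * (δ ^ (2 ^ r - 1) * ∑ x ∈ fat w δ N S r, w x) := by ring
      _ ≤ 2 ^ N * ((2 ^ N) ^ r * ∑ x ∈ S, w x) :=
          mul_le_mul_of_nonneg_left ih (by positivity)
      _ = _ := by rw [pow_succ]; ring

/-- Only the empty face could be fat of codimension N, and its weight 1 would contradict
`weight_fat_le`. -/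
theorem fat_eq_empty (hw : IsProperWeight d w) (hδ : 0 ≤ δ) (hS : ∀ x ∈ S, x.1.card = N)
    (hsmall : (2 ^ N) ^ N * ∑ x ∈ S, w x < δ ^ (2 ^ N - 1)) {r : ℕ} (hr : N ≤ r) :
    fat w δ N S r = ∅ := by
  rw [Finset.eq_empty_iff_forall_notMem]
  intro z hz
  have hc := fat_card hS hz
  obtain rfl : r = N := by omega
  have h1 := weight_fat_le (fun x => (hw.pos x).le) hδ hS (w := w) (δ := δ) r
  have h2 : w z ≤ ∑ z ∈ fat w δ r S r, w z :=
    Finset.single_le_sum (f := w) (fun x _ => (hw.pos x).le) hz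
  rw [hw.weight_bot (by omega)] at h2
  have h3 : 0 ≤ δ ^ (2 ^ r - 1) := by positivity
  nlinarith

open Classical in
-- In the link of z the fat faces form a vertex set A, and the faces b in question are the edges
-- inside A. Since z is not fat, A weighs at most δ^(2^r), so the quadratic term of skeleton
-- expansion is absorbed by the linear one.
theorem weight_badPair_le (hw : IsProperWeight d w) (hδ : 0 ≤ δ) (hS : ∀ x ∈ S, x.1.card = N)
    {r : ℕ} {z : FacePoset X} (hz : z ∉ fat w δ N S (r + 1)) (hzc : z.1.card + (r + 1) = N)
    (hexp : IsSkeletonExpander (linkWeight d w z) (δ ^ 2 ^ r) 1) :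
    ∑ b : FacePoset X with IsBadPair w δ N S r z b, w b ≤
      2 ^ (N + 1) * (2 * δ ^ 2 ^ r) * ∑ x ∈ fat w δ N S r with z ≤ x, w x := by
  set T := ∑ x ∈ fat w δ N S r with z ≤ x, w x with hT
  set c := δ ^ 2 ^ r with hc
  set m := z.1.card with hm
  have hwz := hw.pos z
  have hTlt : T < c * w z := by
    simp only [fat, Finset.mem_filter, Finset.mem_univ, true_and, not_and, not_le] at hz
    exact hz hzc
  let A : Finset (Cells (Link z) 0) := {a | a.1.1 ∈ fat w δ N S r}
  have hcard0 : ∀ a : Cells (Link z) 0, a.1.1.1.card = m + 1 := by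
    intro a
    have := a.2
    rw [dim_link, dim_face, dim_face] at this
    omega
  have hcard1 : ∀ a : Cells (Link z) 1, a.1.1.1.card = m + 2 := by
    intro a
    have := a.2
    rw [dim_link, dim_face, dim_face] at this
    omega
  set s := ∑ a ∈ A, linkWeight d w z a.1 with hs
  have hsT : w z * (m + 1 : ℕ) * s = T := by
    rw [hs, Finset.mul_sum, hT]
    refine Finset.sum_bij (fun a _ => a.1.1) ?_ ?_ ?_ ?_
    · intro a ha
      simp only [A, Finset.mem_filter, Finset.mem_univ, true_and] at ha ⊢
      exact ⟨ha, a.1.2⟩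
    · intro a _ b _ hab
      exact Subtype.ext (Subtype.ext hab)
    · intro b hb
      simp only [Finset.mem_filter] at hb
      have hbc := fat_card hS hb.1
      refine ⟨⟨⟨b, hb.2⟩, ?_⟩, ?_, rfl⟩
      · rw [dim_link, dim_face, dim_face]
        show (b.1.card : ℤ) - 1 - (z.1.card - 1) - 1 = 0
        omega
      · simp only [A, Finset.mem_filter, Finset.mem_univ, true_and]
        exact hb.1
    · intro a _
      rw [← hw.linkWeight_mul z a.1, hcard0 a, ← hm, Nat.choose_succ_self_right]
  have hE : ∑ b : FacePoset X with IsBadPair w δ N S r z b, w b =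
      (w z * (m + 2).choose m) * ∑ e : Cells (Link z) 1 with
        ∃ a ∈ A, ∃ b ∈ A, a ≠ b ∧ a.1 < e.1 ∧ b.1 < e.1, linkWeight d w z e.1 := by
    rw [Finset.mul_sum]
    symm
    refine Finset.sum_bij (fun a _ => a.1.1) ?_ ?_ ?_ ?_
    · intro e he
      simp only [A, Finset.mem_filter, Finset.mem_univ, true_and] at he ⊢
      obtain ⟨a, ha, b, hb, hab, hae, hbe⟩ := he
      refine ⟨?_, a.1.1, ha, b.1.1, hb, ?_, a.1.2, b.1.2, hae.le, hbe.le⟩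
      · rw [hcard1 e]; omega
      · exact fun h => hab (Subtype.ext (Subtype.ext h))
    · intro a _ b _ hab
      exact Subtype.ext (Subtype.ext hab)
    · intro e he
      simp only [Finset.mem_filter, Finset.mem_univ, true_and] at he
      obtain ⟨hec, a, ha, b, hb, hab, hza, hzb, hae, hbe⟩ := he
      have hac := fat_card hS ha
      have hbc := fat_card hS hb
      refine ⟨⟨⟨e, hza.trans hae⟩, ?_⟩, ?_, rfl⟩
      · rw [dim_link, dim_face, dim_face]
        show (e.1.card : ℤ) - 1 - (z.1.card - 1) - 1 = 1
        omega
      · simp only [A, Finset.mem_filter, Finset.mem_univ, true_and]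
        refine ⟨⟨⟨a, hza⟩, ?_⟩, ha, ⟨⟨b, hzb⟩, ?_⟩, hb, ?_, ?_, ?_⟩
        · rw [dim_link, dim_face, dim_face]
          show (a.1.card : ℤ) - 1 - (z.1.card - 1) - 1 = 0
          omega
        · rw [dim_link, dim_face, dim_face]
          show (b.1.card : ℤ) - 1 - (z.1.card - 1) - 1 = 0
          omega
        · intro h
          exact hab (congrArg (fun t : Cells (Link z) 0 => t.1.1) h)
        · refine lt_of_le_of_ne hae fun h => ?_
          have : a = e := congrArg Subtype.val h
          subst this
          omega
        · refine lt_of_le_of_ne hbe fun h => ?_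
          have : b = e := congrArg Subtype.val h
          subst this
          omega
    · intro a _
      rw [← hw.linkWeight_mul z a.1, hcard1 a]
  have hexpA := hexp A
  have hs0 : 0 ≤ s := by
    refine Finset.sum_nonneg fun a _ => ?_
    have h := hw.linkWeight_mul z a.1
    have h0 : (0 : ℝ) < w z * a.1.1.1.card.choose z.1.card :=
      mul_pos hwz (Nat.cast_pos.2 (Nat.choose_pos (face_card_le a.1.2)))
    exact (pos_of_mul_pos_right (h ▸ hw.pos a.1.1) h0.le).le
  have hc0 : 0 ≤ c := by positivity
  have hm1 : (1 : ℝ) ≤ (m + 1 : ℕ) := by exact_mod_cast Nat.succ_le_succ (Nat.zero_le m)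
  have hwsT : w z * s ≤ T := by
    calc w z * s = w z * 1 * s := by ring
      _ ≤ w z * (m + 1 : ℕ) * s := by gcongr
      _ = T := hsT
  have hsc : s ≤ c := by
    refine le_of_mul_le_mul_left (hwsT.trans ?_) hwz
    rw [mul_comm]
    exact hTlt.le
  have hch : ((m + 2).choose m : ℝ) ≤ 2 ^ (N + 1) := by
    have h1 : (m + 2).choose m ≤ 2 ^ (m + 2) := Nat.choose_le_two_pow _ _
    have h2 : 2 ^ (m + 2) ≤ 2 ^ (N + 1) := Nat.pow_le_pow_right (by norm_num) (by omega)
    exact_mod_cast h1.trans h2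
  rw [hE]
  calc (w z * (m + 2).choose m) * ∑ e : Cells (Link z) 1 with
        ∃ a ∈ A, ∃ b ∈ A, a ≠ b ∧ a.1 < e.1 ∧ b.1 < e.1, linkWeight d w z e.1
      ≤ (w z * (m + 2).choose m) * (c * s + 1 * s ^ 2) := by
        refine mul_le_mul_of_nonneg_left (le_of_eq_of_le ?_ hexpA) (by positivity)
        exact Finset.sum_congr (by ext; simp) fun _ _ => rfl
    _ ≤ (w z * (m + 2).choose m) * (2 * c * s) := by
        refine mul_le_mul_of_nonneg_left ?_ (by positivity)
        have := mul_le_mul_of_nonneg_right hsc hs0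
        linarith
    _ = (m + 2).choose m * (2 * c) * (w z * s) := by ring
    _ ≤ 2 ^ (N + 1) * (2 * c) * T := by gcongr

open Classical in
-- Skeleton expansion gains δ^(2^r) in codimension r, while passing from fat faces back to S loses
-- δ^(2^r - 1). The thresholds in `fat` are chosen so that exactly one factor δ survives in every
-- codimension.
theorem weight_bad_le (hw : IsProperWeight d w) (hNd : N ≤ d) (hδ : 0 ≤ δ)
    (hS : ∀ x ∈ S, x.1.card = N)
    (hexp : ∀ r < N, ∀ z : FacePoset X, z.1.card + (r + 1) = N →
      IsSkeletonExpander (linkWeight d w z) (δ ^ 2 ^ r) 1) :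
    ∑ y : FacePoset X with y.1.card = N + 1 ∧ IsBad w δ N S y, w y ≤
      N * (2 * δ * (2 ^ (N + 1)) ^ (N + 3)) * ∑ x ∈ S, w x := by
  have hw0 : ∀ x, 0 ≤ w x := fun x => (hw.pos x).le
  set M : ℝ := 2 ^ (N + 1) with hM
  have hM1 : 1 ≤ M := one_le_pow₀ (by norm_num)
  have hNM : (2 : ℝ) ^ N ≤ M := pow_le_pow_right₀ (by norm_num) (by omega)
  have hsum0 : 0 ≤ ∑ x ∈ S, w x := Finset.sum_nonneg fun x _ => hw0 x
  let Z : ℕ → Finset (FacePoset X) := fun r =>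
    {z | z.1.card + (r + 1) = N ∧ z ∉ fat w δ N S (r + 1)}
  calc ∑ y : FacePoset X with y.1.card = N + 1 ∧ IsBad w δ N S y, w y
      ≤ ∑ y ∈ (Finset.range N).biUnion fun r => (Z r).biUnion fun z =>
          (Finset.univ.filter fun b => IsBadPair w δ N S r z b).biUnion fun b =>
            Finset.univ.filter fun y : FacePoset X => y.1.card = N + 1 ∧ b ≤ y, w y := by
        refine Finset.sum_le_sum_of_subset_of_nonneg ?_ fun x _ _ => hw0 x
        intro y hy
        simp only [Finset.mem_filter, Finset.mem_univ, true_and] at hy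
        obtain ⟨hyc, r, z, b, hzc, hz, hb, hby⟩ := hy
        simp only [Finset.mem_biUnion, Finset.mem_filter, Finset.mem_univ, true_and,
          Finset.mem_range, Z]
        exact ⟨r, by omega, z, ⟨hzc, hz⟩, b, hb, hyc, hby⟩
    _ ≤ ∑ r ∈ Finset.range N, ∑ z ∈ Z r, ∑ b with IsBadPair w δ N S r z b,
          ∑ y : FacePoset X with y.1.card = N + 1 ∧ b ≤ y, w y := by
        refine (sum_biUnion_le_sum hw0 _ _).trans (Finset.sum_le_sum fun r _ => ?_)
        refine (sum_biUnion_le_sum hw0 _ _).trans (Finset.sum_le_sum fun z _ => ?_)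
        exact sum_biUnion_le_sum hw0 _ _
    _ ≤ ∑ r ∈ Finset.range N, ∑ z ∈ Z r, ∑ b with IsBadPair w δ N S r z b, M * w b := by
        refine Finset.sum_le_sum fun r hr => Finset.sum_le_sum fun z hz =>
          Finset.sum_le_sum fun b hb => ?_
        simp only [Finset.mem_filter, Finset.mem_univ, true_and] at hb
        have hbc := hb.1
        rw [hw.sum_above b (by omega) (by omega)]
        refine mul_le_mul_of_nonneg_right ?_ (hw0 b)
        rw [hM]
        exact_mod_cast Nat.choose_le_two_pow (N + 1) b.1.card
    _ ≤ ∑ r ∈ Finset.range N, ∑ z ∈ Z r,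
          M * (M * (2 * δ ^ 2 ^ r) * ∑ x ∈ fat w δ N S r with z ≤ x, w x) := by
        refine Finset.sum_le_sum fun r hr => Finset.sum_le_sum fun z hz => ?_
        simp only [Finset.mem_filter, Finset.mem_univ, true_and, Z] at hz
        rw [← Finset.mul_sum]
        refine mul_le_mul_of_nonneg_left ?_ (by positivity)
        exact weight_badPair_le hw hδ hS hz.2 hz.1 (hexp r (Finset.mem_range.1 hr) z hz.1)
    _ ≤ ∑ r ∈ Finset.range N, M * (M * (2 * δ ^ 2 ^ r) * (M * ∑ x ∈ fat w δ N S r, w x)) := by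
        refine Finset.sum_le_sum fun r hr => ?_
        rw [← Finset.mul_sum, ← Finset.mul_sum]
        refine mul_le_mul_of_nonneg_left (mul_le_mul_of_nonneg_left ?_ (by positivity))
          (by positivity)
        refine (sum_sum_above_le hw0 (fat w δ N S r) (Z r) (m := N) fun x hx => ?_).trans ?_
        · have := fat_card hS hx
          omega
        · exact mul_le_mul_of_nonneg_right hNM (Finset.sum_nonneg fun x _ => hw0 x)
    _ ≤ ∑ r ∈ Finset.range N, (2 * δ * M ^ (N + 3)) * ∑ x ∈ S, w x := by
        refine Finset.sum_le_sum fun r hr => ?_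
        have hrN := Finset.mem_range.1 hr
        have he : δ ^ 2 ^ r = δ * δ ^ (2 ^ r - 1) := by
          rw [← pow_succ', Nat.sub_add_cancel Nat.one_le_two_pow]
        have h1 := weight_fat_le hw0 hδ hS (w := w) (δ := δ) r
        have h2 : ((2 : ℝ) ^ N) ^ r ≤ M ^ N :=
          (pow_le_pow_left₀ (by positivity) hNM r).trans (pow_le_pow_right₀ hM1 hrN.le)
        -- The three factors M come from passing from b to the faces y above it, from the
        -- normalisation of link weights, and from the number of faces z below one fat face.
        calc M * (M * (2 * δ ^ 2 ^ r) * (M * ∑ x ∈ fat w δ N S r, w x))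
            = 2 * δ * M ^ 3 * (δ ^ (2 ^ r - 1) * ∑ x ∈ fat w δ N S r, w x) := by
              rw [he]; ring
          _ ≤ 2 * δ * M ^ 3 * (M ^ N * ∑ x ∈ S, w x) := by
              refine mul_le_mul_of_nonneg_left (h1.trans ?_) (by positivity)
              exact mul_le_mul_of_nonneg_right h2 hsum0
          _ = _ := by rw [pow_add]; ring
    _ = _ := by
        rw [Finset.sum_const, nsmul_eq_mul, Finset.card_range]
        ring

end Fat

/-! ### Extension by zero from a link -/

section Extension

variable {R : Type u} [CommRing R] {P : Type v} [PartialOrder P] [GradeOrder ℤ P]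
  {F : PosetSheaf.{u, v, t} R P} {i : ℤ}

open Classical in
/-- The cochain that agrees with `f` on the faces in `Q` and vanishes elsewhere. -/
noncomputable def mask (Q : P → Prop) (f : Cochain F i) : Cochain F i :=
  fun x => if Q x.1 then f x else 0

theorem mask_apply_ne_zero {Q : P → Prop} {f : Cochain F i} {x : Cells P i} :
    mask Q f x ≠ 0 ↔ Q x.1 ∧ f x ≠ 0 := by
  unfold mask
  split_ifs with h <;> simp [h]

/-- The restriction of a cochain to the link `X_u`. -/
def linkRestrict (F : PosetSheaf.{u, v, t} R P) (u : P) (i : ℤ) (f : Cochain F i) :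
    Cochain (F.link u) (i - dim u - 1) :=
  fun x => f ⟨x.1.1, by
    have := x.2
    rw [dim_link] at this
    omega⟩

theorem extend_apply_of_le {u : P} {f : Cochain (F.link u) (i - dim u - 1)} {x : P}
    (h : u ≤ x) (hx : dim x = i) (hx' : dim (⟨x, h⟩ : Link u) = i - dim u - 1) :
    extend F u i f ⟨x, hx⟩ = f ⟨⟨x, h⟩, hx'⟩ := by
  classical
  exact dif_pos h

theorem extend_apply_of_not_le {u : P} {f : Cochain (F.link u) (i - dim u - 1)} {x : Cells P i}
    (h : ¬ u ≤ x.1) : extend F u i f x = 0 := by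
  classical
  exact dif_neg h

theorem extend_linkRestrict {u : P} {f : Cochain F i} (hf : ∀ x, f x ≠ 0 → u ≤ x.1) :
    extend F u i (linkRestrict F u i f) = f := by
  funext x
  by_cases h : u ≤ x.1
  · exact extend_apply_of_le h x.2 (by rw [dim_link, x.2])
  · rw [extend_apply_of_not_le h]
    by_contra hx
    exact h (hf x (Ne.symm hx))

theorem extend_sub (F : PosetSheaf.{u, v, t} R P) (u : P) (i : ℤ)
    (f g : Cochain (F.link u) (i - dim u - 1)) :
    extend F u i (f - g) = extend F u i f - extend F u i g := by
  funext x
  rw [Pi.sub_apply]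
  by_cases h : u ≤ x.1
  · have hx : dim (⟨x.1, h⟩ : Link u) = i - dim u - 1 := by rw [dim_link, x.2]
    have hf := extend_apply_of_le (f := f) h x.2 hx
    have hg := extend_apply_of_le (f := g) h x.2 hx
    exact (extend_apply_of_le h x.2 hx).trans (congrArg₂ (fun a b => a - b) hf hg).symm
  · rw [extend_apply_of_not_le h, extend_apply_of_not_le h, extend_apply_of_not_le h, sub_zero]

theorem extend_neg (F : PosetSheaf.{u, v, t} R P) (u : P) (i : ℤ)
    (f : Cochain (F.link u) (i - dim u - 1)) :
    extend F u i (-f) = - extend F u i f := by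
  have h0 : extend F u i (0 : Cochain (F.link u) (i - dim u - 1)) = 0 := by
    have h := extend_sub F u i 0 0
    rwa [sub_self, sub_self] at h
  have h := extend_sub F u i 0 f
  rwa [zero_sub, h0, zero_sub] at h

end Extension

/-! ### Supports, norms and coboundaries -/

section Norms

variable {R : Type u} [CommRing R] {P : Type v} [PartialOrder P] [GradeOrder ℤ P] [Fintype P]
  {F : PosetSheaf.{u, v, t} R P} {w : P → ℝ} {i j : ℤ}

open Classical in
/-- The support of a cochain, as a set of faces. -/
noncomputable def support (f : Cochain F i) : Finset P :=
  {x : P | ∃ h : dim x = i, f ⟨x, h⟩ ≠ 0}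

theorem mem_support {f : Cochain F i} {x : P} :
    x ∈ support f ↔ ∃ h : dim x = i, f ⟨x, h⟩ ≠ 0 := by
  classical
  simp [support]

theorem mem_support_cell {f : Cochain F i} {x : Cells P i} : x.1 ∈ support f ↔ f x ≠ 0 := by
  rw [mem_support]
  exact ⟨fun ⟨_, h⟩ => h, fun h => ⟨x.2, h⟩⟩

theorem wnorm_eq_sum_support (w : P → ℝ) (f : Cochain F i) :
    wnorm w f = ∑ x ∈ support f, w x := by
  classical
  unfold wnorm
  refine Finset.sum_bij (fun x _ => x.1) ?_ ?_ ?_ ?_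
  · intro x hx
    simp only [Finset.mem_filter, Finset.mem_univ, true_and] at hx
    exact mem_support_cell.2 hx
  · intro a _ b _ h
    exact Subtype.ext h
  · intro x hx
    obtain ⟨h, hx⟩ := mem_support.1 hx
    exact ⟨⟨x, h⟩, by simpa using hx, rfl⟩
  · intro _ _
    rfl

theorem wnorm_nonneg (hw : ∀ x, 0 ≤ w x) (f : Cochain F i) : 0 ≤ wnorm w f := by
  rw [wnorm_eq_sum_support]
  exact Finset.sum_nonneg fun x _ => hw x

theorem wnorm_le_of_support_subset (hw : ∀ x, 0 ≤ w x) {f : Cochain F i} {s : Finset P}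
    (h : support f ⊆ s) : wnorm w f ≤ ∑ x ∈ s, w x := by
  rw [wnorm_eq_sum_support]
  exact Finset.sum_le_sum_of_subset_of_nonneg h fun x _ _ => hw x

theorem wnorm_add_le (hw : ∀ x, 0 ≤ w x) (f g : Cochain F i) :
    wnorm w (f + g) ≤ wnorm w f + wnorm w g := by
  classical
  have h : support (f + g) ⊆ support f ∪ support g := by
    intro x hx
    obtain ⟨hd, hx⟩ := mem_support.1 hx
    rw [Finset.mem_union, mem_support, mem_support]
    by_contra! hcon
    exact hx (by rw [Pi.add_apply, hcon.1 hd, hcon.2 hd, add_zero])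
  refine (wnorm_le_of_support_subset hw h).trans ?_
  have h1 := Finset.sum_union_inter (s₁ := support f) (s₂ := support g) (f := w)
  have h2 : 0 ≤ ∑ x ∈ support f ∩ support g, w x := Finset.sum_nonneg fun x _ => hw x
  rw [wnorm_eq_sum_support, wnorm_eq_sum_support]
  linarith

theorem wnorm_neg (w : P → ℝ) (f : Cochain F i) : wnorm w (-f) = wnorm w f := by
  classical
  unfold wnorm
  exact Finset.sum_congr (Finset.filter_congr fun x _ => by simp) fun _ _ => rfl

theorem wnorm_sub_le (hw : ∀ x, 0 ≤ w x) (f g : Cochain F i) :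
    wnorm w (f - g) ≤ wnorm w f + wnorm w g := by
  rw [sub_eq_add_neg, ← wnorm_neg w g]
  exact wnorm_add_le hw f (-g)

theorem eq_zero_of_wnorm_eq_zero (hw : ∀ x, 0 < w x) {f : Cochain F i} (h : wnorm w f = 0) :
    f = 0 := by
  rw [wnorm_eq_sum_support, Finset.sum_eq_zero_iff_of_nonneg fun x _ => (hw x).le] at h
  funext x
  by_contra hx
  exact (hw x.1).ne' (h x.1 (mem_support_cell.2 hx))

/-- The norm depends only on the support. Hence minima are attained and the algorithm stops, even
though the modules may be infinite. -/
theorem finite_range_wnorm (w : P → ℝ) (F : PosetSheaf.{u, v, t} R P) (i : ℤ) :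
    (Set.range fun f : Cochain F i => wnorm w f).Finite := by
  refine (Set.finite_range fun s : Finset P => ∑ x ∈ s, w x).subset ?_
  rintro _ ⟨f, rfl⟩
  exact ⟨support f, (wnorm_eq_sum_support w f).symm⟩

theorem wdist_le (hw : ∀ x, 0 ≤ w x) (f : Cochain F i) (S : Submodule R (Cochain F i))
    {g : Cochain F i} (hg : g ∈ S) : wdist w f S ≤ wnorm w (f - g) :=
  ciInf_le (f := fun g : S => wnorm w (f - g.1))
    ⟨0, by rintro _ ⟨g, rfl⟩; exact wnorm_nonneg hw _⟩ ⟨g, hg⟩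

theorem le_wdist (f : Cochain F i) (S : Submodule R (Cochain F i)) {c : ℝ}
    (h : ∀ g ∈ S, c ≤ wnorm w (f - g)) : c ≤ wdist w f S :=
  le_ciInf fun g => h g.1 g.2

theorem wnorm_coboundary_congr (w : P → ℝ) (o : Orientation R P) {j j' : ℤ} (h : j = j')
    (f : Cochain F i) : wnorm w (coboundary o F i j f) = wnorm w (coboundary o F i j' f) := by
  subst h
  rfl

/-- The supremum need not be known to be attained: a failure at f gives a ratio below ε, and some
admissible μ exceeds that ratio. -/
theorem cbe_mul_wdist_le (hw : ∀ x, 0 ≤ w x) {o : Orientation R P} {ε : ℝ}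
    (h : (ε : EReal) ≤ cbe o w F i) (f : Cochain F i) :
    ε * wdist w f (coboundaries o F i) ≤ wnorm w (coboundary o F i (i + 1) f) := by
  by_contra! hcon
  have hd : 0 ≤ wdist w f (coboundaries o F i) := le_wdist _ _ fun g _ => wnorm_nonneg hw _
  have hn := wnorm_nonneg hw (coboundary o F i (i + 1) f)
  have hd' : 0 < wdist w f (coboundaries o F i) := by
    refine lt_of_le_of_ne hd fun h0 => ?_
    rw [← h0, mul_zero] at hcon
    exact hcon.not_ge hn
  have h1 : wnorm w (coboundary o F i (i + 1) f) / wdist w f (coboundaries o F i) < ε := by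
    rwa [div_lt_iff₀ hd']
  have h2 := lt_of_lt_of_le (EReal.coe_lt_coe_iff.2 h1) h
  obtain ⟨_, ⟨μ, ⟨-, hμ⟩, rfl⟩, hlt⟩ := lt_sSup_iff.1 h2
  have h3 := EReal.coe_lt_coe_iff.1 hlt
  rw [div_lt_iff₀ hd'] at h3
  exact h3.not_ge (hμ f)

theorem support_coboundary {o : Orientation R P} {f : Cochain F i} {y : P}
    (hy : y ∈ support (coboundary o F i j f)) : ∃ x ∈ support f, x ≤ y := by
  classical
  obtain ⟨hd, hy⟩ := mem_support.1 hy
  obtain ⟨x, -, hx⟩ := Finset.exists_ne_zero_of_sum_ne_zero hy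
  by_cases hxy : x.1 ≤ y
  · refine ⟨x.1, mem_support_cell.2 fun h0 => hx ?_, hxy⟩
    simp [h0]
  · exact absurd (dif_neg hxy) hx

theorem coboundary_apply_congr (o : Orientation R P) {f g : Cochain F i} {y : Cells P j}
    (h : ∀ x : Cells P i, x.1 ≤ y.1 → f x = g x) :
    coboundary o F i j f y = coboundary o F i j g y := by
  classical
  refine Finset.sum_congr rfl fun x _ => ?_
  by_cases hx : x.1 ≤ y.1
  · simp [h x hx]
  · simp [hx]

theorem wnorm_mask_add (w : P → ℝ) (Q : P → Prop) (f : Cochain F i) :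
    wnorm w (mask Q f) + wnorm w (f - mask Q f) = wnorm w f := by
  classical
  unfold wnorm
  rw [← Finset.sum_filter_add_sum_filter_not (Finset.univ.filter fun x => f x ≠ 0)
    (fun x => Q x.1), Finset.filter_filter, Finset.filter_filter]
  congr 1
  · refine Finset.sum_congr (Finset.filter_congr fun x _ => ?_) fun _ _ => rfl
    rw [mask_apply_ne_zero, and_comm]
  · refine Finset.sum_congr (Finset.filter_congr fun x _ => ?_) fun _ _ => rfl
    rw [Pi.sub_apply]
    unfold mask
    split_ifs with h <;> simp [h]

theorem coboundary_extend (o : Orientation R P) (u : P) (i j : ℤ)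
    (f : Cochain (F.link u) (i - dim u - 1)) :
    coboundary o F i j (extend F u i f) =
      extend F u j (coboundary (o.link u) (F.link u) (i - dim u - 1) (j - dim u - 1) f) := by
  classical
  funext y
  by_cases hy : u ≤ y.1
  · rw [extend_apply_of_le hy y.2 (by rw [dim_link, y.2])]
    symm
    refine Finset.sum_bij_ne_zero (fun x _ _ => ⟨x.1.1, ?_⟩) ?_ ?_ ?_ ?_
    · have := x.2
      rw [dim_link] at this
      omega
    · intro x _ _
      exact Finset.mem_univ _
    · intro x _ _ x' _ _ h
      exact Subtype.ext (Subtype.ext (congrArg (fun t : Cells P i => t.1) h))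
    · intro x _ hx
      have hxy : x.1 ≤ y.1 := by
        by_contra h
        exact hx (dif_neg h)
      have hux : u ≤ x.1 := by
        by_contra h
        refine hx ?_
        rw [dif_pos hxy, extend_apply_of_not_le h, map_zero, smul_zero]
      have hdx : dim (⟨x.1, hux⟩ : Link u) = i - dim u - 1 := by rw [dim_link, x.2]
      have hxy' : (⟨x.1, hux⟩ : Link u) ≤ ⟨y.1, hy⟩ := hxy
      refine ⟨⟨⟨x.1, hux⟩, hdx⟩, Finset.mem_univ _, fun h0 => hx ?_, rfl⟩
      refine (dif_pos hxy).trans ?_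
      rw [show extend F u i f x = _ from extend_apply_of_le hux x.2 hdx]
      exact (dif_pos hxy').symm.trans h0
    · intro x _ hx
      have hxy : x.1 ≤ (⟨y.1, hy⟩ : Link u) := by
        by_contra h
        exact hx (dif_neg h)
      have hxy' : x.1.1 ≤ y.1 := hxy
      refine (dif_pos hxy).trans (Eq.trans ?_ (dif_pos hxy').symm)
      rw [extend_apply_of_le x.1.2 _ x.2]
      rfl
  · rw [extend_apply_of_not_le hy]
    refine Finset.sum_eq_zero fun x _ => ?_
    by_cases hxy : x.1 ≤ y.1
    · rw [dif_pos hxy, extend_apply_of_not_le fun h => hy (h.trans hxy), map_zero, smul_zero]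
    · exact dif_neg hxy

theorem mem_coboundaries {o : Orientation R P} {f : Cochain F i} (h : j = i - 1)
    (hf : f ∈ coboundaries o F i) : ∃ g : Cochain F j, coboundary o F j i g = f := by
  subst h
  exact hf

end Norms

/-! ### Local expansion and the vanishing of small locally minimal cocycles -/

section Faces

variable {R : Type u} [CommRing R] {V : Type v} {X : PreAbstractSimplicialComplex V}
  [Fintype (FacePoset X)] {d : ℕ} {w : FacePoset X → ℝ}
  {F : PosetSheaf.{u, v, t} R (FacePoset X)} {i : ℤ}

theorem linkWeight_nonneg (hw : IsProperWeight d w) (u : FacePoset X) (x : Link u) :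
    0 ≤ linkWeight d w u x := by
  have h := hw.linkWeight_mul u x
  have h0 : (0 : ℝ) < w u * x.1.1.card.choose u.1.card :=
    mul_pos (hw.pos u) (Nat.cast_pos.2 (Nat.choose_pos (face_card_le x.2)))
  exact (pos_of_mul_pos_right (h ▸ hw.pos x.1) h0.le).le

theorem wnorm_extend (hw : IsProperWeight d w) {n : ℕ} (hn : i + 1 = n) (u : FacePoset X)
    (f : Cochain (F.link u) (i - dim u - 1)) :
    wnorm w (extend F u i f) = w u * n.choose u.1.card * wnorm (linkWeight d w u) f := by
  classical
  rw [wnorm_eq_sum_support, wnorm_eq_sum_support, Finset.mul_sum]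
  symm
  refine Finset.sum_bij (fun x _ => x.1) ?_ ?_ ?_ ?_
  · intro x hx
    obtain ⟨hd, hx⟩ := mem_support.1 hx
    have hd' := hd
    rw [dim_link] at hd'
    refine mem_support.2 ⟨by omega, ?_⟩
    rwa [extend_apply_of_le x.2 _ hd]
  · intro a _ b _ h
    exact Subtype.ext h
  · intro x hx
    obtain ⟨hd, hx⟩ := mem_support.1 hx
    have hux : u ≤ x := by
      by_contra h
      exact hx (extend_apply_of_not_le h)
    have hd' : dim (⟨x, hux⟩ : Link u) = i - dim u - 1 := by rw [dim_link, hd]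
    rw [extend_apply_of_le hux hd hd'] at hx
    exact ⟨⟨x, hux⟩, mem_support.2 ⟨hd', hx⟩, rfl⟩
  · intro x hx
    obtain ⟨hd, -⟩ := mem_support.1 hx
    rw [dim_link, dim_face] at hd
    have hc : x.1.1.card = n := by omega
    rw [← hw.linkWeight_mul u x, hc]

theorem wnorm_extend_le (hw : IsProperWeight d w) {n : ℕ} (hn : i + 1 = n) (hnd : n ≤ d + 1)
    {u : FacePoset X} (hu : u.1.card ≤ n) (f : Cochain (F.link u) (i - dim u - 1)) :
    wnorm w (extend F u i f) ≤ 2 ^ n * w u := by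
  classical
  have h : support (extend F u i f) ⊆
      Finset.univ.filter fun y : FacePoset X => y.1.card = n ∧ u ≤ y := by
    intro x hx
    obtain ⟨hd, hx⟩ := mem_support.1 hx
    simp only [Finset.mem_filter, Finset.mem_univ, true_and]
    refine ⟨?_, ?_⟩
    · rw [dim_face] at hd
      omega
    · by_contra h
      exact hx (extend_apply_of_not_le h)
  refine (wnorm_le_of_support_subset (fun x => (hw.pos x).le) h).trans ?_
  rw [hw.sum_above u hu hnd]
  refine mul_le_mul_of_nonneg_right ?_ (hw.pos u).le
  exact_mod_cast Nat.choose_le_two_pow n _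

theorem wnorm_coboundary_le (hw : IsProperWeight d w) (o : Orientation R (FacePoset X)) {n : ℕ}
    (hn : i + 1 = n) (hnd : n ≤ d) (f : Cochain F i) :
    wnorm w (coboundary o F i (i + 1) f) ≤ (n + 1) * wnorm w f := by
  classical
  have hw0 : ∀ x, 0 ≤ w x := fun x => (hw.pos x).le
  have h : support (coboundary o F i (i + 1) f) ⊆ (support f).biUnion fun x =>
      Finset.univ.filter fun y : FacePoset X => y.1.card = n + 1 ∧ x ≤ y := by
    intro y hy
    obtain ⟨hd, -⟩ := mem_support.1 hy
    obtain ⟨x, hx, hxy⟩ := support_coboundary hy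
    simp only [Finset.mem_biUnion, Finset.mem_filter, Finset.mem_univ, true_and]
    refine ⟨x, hx, ?_, hxy⟩
    rw [dim_face] at hd
    omega
  refine (wnorm_le_of_support_subset hw0 h).trans ((sum_biUnion_le_sum hw0 _ _).trans ?_)
  rw [wnorm_eq_sum_support, Finset.mul_sum]
  refine Finset.sum_le_sum fun x hx => ?_
  obtain ⟨hd, -⟩ := mem_support.1 hx
  rw [dim_face] at hd
  have hc : x.1.card = n := by omega
  rw [hw.sum_above x (by omega) (by omega), hc, Nat.choose_succ_self_right]
  push_cast
  rfl

theorem wnorm_le_one (hw : IsProperWeight d w) {n : ℕ} (hn : i + 1 = n) (hnd : n ≤ d + 1)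
    (f : Cochain F i) : wnorm w f ≤ 1 := by
  classical
  let e : FacePoset X := ⟨∅, Or.inl rfl⟩
  have h : support f ⊆ Finset.univ.filter fun y : FacePoset X => y.1.card = n ∧ e ≤ y := by
    intro x hx
    obtain ⟨hd, -⟩ := mem_support.1 hx
    simp only [Finset.mem_filter, Finset.mem_univ, true_and]
    refine ⟨?_, Finset.empty_subset x.1⟩
    rw [dim_face] at hd
    omega
  have he : e.1.card = 0 := rfl
  refine (wnorm_le_of_support_subset (fun x => (hw.pos x).le) h).trans ?_
  rw [hw.sum_above e (by omega) hnd, hw.weight_bot he, he]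
  simp

/-- Local minimality passes from f to its part H = `mask Q f`: since f - b^u = (H - b^u) + (f - H)
and ‖f‖ = ‖H‖ + ‖f - H‖, subtracting b^u lowers ‖H‖ by at most q w(u). As H is supported above u,
this bounds its distance to the coboundaries of the link. -/
theorem local_expansion (hw : IsProperWeight d w) {o : Orientation R (FacePoset X)} {n : ℕ}
    (hn : i + 1 = n) {ε q : ℝ} (hε : 0 ≤ ε) {u : FacePoset X} (hu : u.1.card ≤ n)
    (hcbe : (ε : EReal) ≤ cbe (o.link u) (linkWeight d w u) (F.link u) (i - dim u - 1))
    {f : Cochain F i}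
    (hmin : ∀ b ∈ coboundaries (o.link u) (F.link u) (i - dim u - 1),
      wnorm w f - q * w u ≤ wnorm w (f + extend F u i b))
    {Q : FacePoset X → Prop} (hQ : ∀ x, Q x → u ≤ x) :
    ε * (wnorm w (mask Q f) - q * w u) ≤ wnorm w (coboundary o F i (i + 1) (mask Q f)) := by
  have hw0 : ∀ x, 0 ≤ w x := fun x => (hw.pos x).le
  set H := mask Q f with hH
  set h := linkRestrict F u i H with hh
  have hext : extend F u i h = H :=
    extend_linkRestrict fun x hx => hQ _ (mask_apply_ne_zero.1 hx).1
  have hwu := hw.pos u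
  have hC : (0 : ℝ) < n.choose u.1.card := Nat.cast_pos.2 (Nat.choose_pos hu)
  -- Extension by zero scales norms by w(u) times a binomial coefficient, which only grows from
  -- degree i to degree i + 1.
  have hCC : (n.choose u.1.card : ℝ) ≤ (n + 1).choose u.1.card :=
    Nat.cast_le.2 (Nat.choose_le_choose _ (Nat.le_succ n))
  have h1 : (wnorm w H - q * w u) / (w u * n.choose u.1.card) ≤
      wdist (linkWeight d w u) h (coboundaries (o.link u) (F.link u) (i - dim u - 1)) := by
    refine le_wdist _ _ fun b hb => ?_
    rw [div_le_iff₀ (by positivity), mul_comm (wnorm _ _), ← wnorm_extend hw hn, extend_sub, hext]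
    have h2 := hmin (-b) (Submodule.neg_mem _ hb)
    rw [extend_neg, ← sub_eq_add_neg] at h2
    have h3 := wnorm_mask_add w Q f
    have h4 := wnorm_add_le hw0 (H - extend F u i b) (f - H)
    have h5 : H - extend F u i b + (f - H) = f - extend F u i b := by abel
    rw [h5] at h4
    rw [← hH] at h3
    linarith
  have h2 := cbe_mul_wdist_le (linkWeight_nonneg hw u) hcbe h
  have h3 : wnorm w (coboundary o F i (i + 1) H) = w u * (n + 1 : ℕ).choose u.1.card *
      wnorm (linkWeight d w u)
        (coboundary (o.link u) (F.link u) (i - dim u - 1) (i - dim u - 1 + 1) h) := by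
    rw [← hext, coboundary_extend, wnorm_extend hw (n := n + 1) (by push_cast; omega),
      wnorm_coboundary_congr _ _ (show i + 1 - dim u - 1 = i - dim u - 1 + 1 by ring)]
  have h0 := wnorm_nonneg (linkWeight_nonneg hw u)
    (coboundary (o.link u) (F.link u) (i - dim u - 1) (i - dim u - 1 + 1) h)
  rw [h3]
  calc ε * (wnorm w H - q * w u)
      = w u * n.choose u.1.card * (ε * ((wnorm w H - q * w u) / (w u * n.choose u.1.card))) := by
        field_simp
    _ ≤ w u * n.choose u.1.card * wnorm (linkWeight d w u)
        (coboundary (o.link u) (F.link u) (i - dim u - 1) (i - dim u - 1 + 1) h) := by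
        refine mul_le_mul_of_nonneg_left (le_trans ?_ h2) (by positivity)
        exact mul_le_mul_of_nonneg_left h1 hε
    _ ≤ _ := by
        refine mul_le_mul_of_nonneg_right ?_ h0
        exact mul_le_mul_of_nonneg_left hCC hwu.le

theorem eq_zero_of_locally_minimal (hw : IsProperWeight d w) {o : Orientation R (FacePoset X)}
    {N : ℕ} (hi : i + 1 = N) (hNd : N ≤ d) {K ε q : ℝ} (hK0 : 0 < K)
    (hK : 4 * (2 ^ (N + 1)) ^ (N + 6) * K ≤ 1) (hε : 0 < ε) (hε1 : ε ≤ 1) (hq0 : 0 ≤ q)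
    (hq : q ≤ K * (K * ε) ^ (2 ^ (N - 1) - 1))
    (hcbe : ∀ u : FacePoset X, 0 ≤ dim u → dim u ≤ i →
      (ε : EReal) ≤ cbe (o.link u) (linkWeight d w u) (F.link u) (i - dim u - 1))
    (hexp : ∀ r < N, ∀ z : FacePoset X, z.1.card + (r + 1) = N →
      IsSkeletonExpander (linkWeight d w z) ((K * ε) ^ 2 ^ r) 1)
    {g : Cochain F i} (hg : coboundary o F i (i + 1) g = 0)
    (hmin : ∀ u : FacePoset X, 0 ≤ dim u → dim u ≤ i →
      ∀ b ∈ coboundaries (o.link u) (F.link u) (i - dim u - 1),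
        wnorm w g - q * w u ≤ wnorm w (g + extend F u i b))
    (hsmall : (2 ^ N) ^ N * wnorm w g < (K * ε) ^ (2 ^ N - 1)) : g = 0 := by
  classical
  have hw0 : ∀ x, 0 ≤ w x := fun x => (hw.pos x).le
  set δ := K * ε with hδdef
  have hδ : 0 ≤ δ := by positivity
  set M : ℝ := 2 ^ (N + 1) with hM
  have hM1 : 1 ≤ M := one_le_pow₀ (by norm_num)
  have hK1 : K ≤ 1 := by
    have : 1 ≤ M ^ (N + 6) := one_le_pow₀ hM1
    nlinarith
  have hδ1 : δ ≤ 1 := mul_le_one₀ hK1 hε.le hε1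
  set S := support g with hSdef
  have hS : ∀ x ∈ S, x.1.card = N := by
    intro x hx
    obtain ⟨hd, -⟩ := mem_support.1 hx
    rw [dim_face] at hd
    omega
  have hnorm : wnorm w g = ∑ x ∈ S, w x := wnorm_eq_sum_support w g
  set G := wnorm w g with hG
  have hG0 : 0 ≤ G := wnorm_nonneg hw0 g
  have hempty : ∀ r, N ≤ r → fat w δ N S r = ∅ := fun r hr =>
    fat_eq_empty hw hδ hS (hnorm ▸ hsmall) hr
  let H : ℕ → FacePoset X → Cochain F i := fun r u => mask (Reach w δ N S r u) g
  let Bad : Finset (FacePoset X) := {y | y.1.card = N + 1 ∧ IsBad w δ N S y}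
  have hcover : G ≤ ∑ r ∈ Finset.range N, ∑ u ∈ terminal w δ N S r, wnorm w (H r u) := by
    have hsub : S ⊆ (Finset.range N).biUnion fun r =>
        (terminal w δ N S r).biUnion fun u => support (H r u) := by
      intro x hx
      obtain ⟨r, u, hu, hr⟩ := exists_reach_terminal (w := w) (δ := δ) hS hx
      simp only [Finset.mem_biUnion, Finset.mem_range]
      refine ⟨r, ?_, u, hu, ?_⟩
      · by_contra hcon
        have := hr.mem_fat
        rw [hempty r (not_lt.1 hcon)] at this
        exact absurd this (Finset.notMem_empty _)
      · obtain ⟨hd, hx⟩ := mem_support.1 hx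
        exact mem_support.2 ⟨hd, mask_apply_ne_zero.2 ⟨hr, hx⟩⟩
    refine (wnorm_le_of_support_subset hw0 hsub).trans ?_
    refine (sum_biUnion_le_sum hw0 _ _).trans (Finset.sum_le_sum fun r _ => ?_)
    refine (sum_biUnion_le_sum hw0 _ _).trans (Finset.sum_le_sum fun u _ => ?_)
    rw [wnorm_eq_sum_support]
  have hdH : ∀ r, ∀ u ∈ terminal w δ N S r,
      wnorm w (coboundary o F i (i + 1) (H r u)) ≤ ∑ y ∈ Bad with u ≤ y, w y := by
    intro r u hu
    refine wnorm_le_of_support_subset hw0 fun y hy => ?_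
    obtain ⟨x, hx, hxy⟩ := support_coboundary hy
    obtain ⟨hd, hy⟩ := mem_support.1 hy
    obtain ⟨hdx, hx⟩ := mem_support.1 hx
    have hr := (mask_apply_ne_zero.1 hx).1
    have hyc : y.1.card = N + 1 := by
      rw [dim_face] at hd
      omega
    simp only [Finset.mem_filter, Finset.mem_univ, true_and, Bad]
    refine ⟨⟨hyc, ?_⟩, hr.le.trans hxy⟩
    by_contra hbad
    refine hy ?_
    -- Over a good y, every member of S below y reaches `u`, so `H r u` and `g` agree below y.
    have h1 : coboundary o F i (i + 1) (H r u) ⟨y, hd⟩ = coboundary o F i (i + 1) g ⟨y, hd⟩ := by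
      refine coboundary_apply_congr o fun x' hx' => ?_
      by_cases h0 : g x' = 0
      · by_contra hne
        refine hne ?_
        rw [h0]
        by_contra hne'
        exact (mask_apply_ne_zero.1 hne').2 h0
      · exact if_pos (hr.of_terminal hS hyc hbad hu hxy (mem_support_cell.2 h0) hx')
    rw [h1, hg]
    rfl
  have hloc : ∀ r < N, ∀ u ∈ terminal w δ N S r,
      ε * (wnorm w (H r u) - q * w u) ≤ ∑ y ∈ Bad with u ≤ y, w y := by
    intro r hr u hu
    refine le_trans ?_ (hdH r u hu)
    have hu' : u ∈ fat w δ N S r := (Finset.mem_filter.1 hu).1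
    have hc := fat_card hS hu'
    have h0 : 0 ≤ dim u := by rw [dim_face]; omega
    have h1 : dim u ≤ i := by rw [dim_face]; omega
    exact local_expansion hw hi hε.le (by omega) (hcbe u h0 h1) (hmin u h0 h1)
      fun x hx => hx.le
  have hbad := weight_bad_le hw hNd hδ hS hexp
  rw [← hnorm] at hbad
  have hupper : ∑ r ∈ Finset.range N, ∑ u ∈ terminal w δ N S r, ∑ y ∈ Bad with u ≤ y, w y ≤
      N * (M * (N * (2 * δ * M ^ (N + 3)) * G)) := by
    have : ∀ r ∈ Finset.range N, ∑ u ∈ terminal w δ N S r, ∑ y ∈ Bad with u ≤ y, w y ≤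
        M * (N * (2 * δ * M ^ (N + 3)) * G) := by
      intro r _
      refine (sum_sum_above_le hw0 Bad _ (m := N + 1) fun y hy => ?_).trans ?_
      · simp only [Finset.mem_filter, Finset.mem_univ, true_and, Bad] at hy
        omega
      · exact mul_le_mul_of_nonneg_left hbad (by positivity)
    refine (Finset.sum_le_sum this).trans ?_
    rw [Finset.sum_const, nsmul_eq_mul, Finset.card_range]
  have hqsum : ∑ r ∈ Finset.range N, ∑ u ∈ terminal w δ N S r, q * w u ≤
      N * (K * (M ^ N * G)) := by
    have : ∀ r ∈ Finset.range N, ∑ u ∈ terminal w δ N S r, q * w u ≤ K * (M ^ N * G) := by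
      intro r hr
      have hrN := Finset.mem_range.1 hr
      -- The exponent in the bound on q belongs to N - 1, the largest codimension that occurs, and
      -- compensates the loss in `weight_fat_le`.
      have hle : 2 ^ r - 1 ≤ 2 ^ (N - 1) - 1 :=
        Nat.sub_le_sub_right (Nat.pow_le_pow_right (by norm_num) (by omega)) 1
      have hq' : q ≤ K * δ ^ (2 ^ r - 1) :=
        hq.trans (mul_le_mul_of_nonneg_left (pow_le_pow_of_le_one hδ hδ1 hle) hK0.le)
      have h1 : ∑ u ∈ terminal w δ N S r, w u ≤ ∑ u ∈ fat w δ N S r, w u :=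
        Finset.sum_le_sum_of_subset_of_nonneg (Finset.filter_subset _ _) fun x _ _ => hw0 x
      have h2 : 0 ≤ ∑ u ∈ fat w δ N S r, w u := Finset.sum_nonneg fun x _ => hw0 x
      have h3 := weight_fat_le hw0 hδ hS (w := w) (δ := δ) r
      rw [← hnorm] at h3
      have h4 : ((2 : ℝ) ^ N) ^ r ≤ M ^ N :=
        (pow_le_pow_left₀ (by positivity)
          (pow_le_pow_right₀ (by norm_num) (Nat.le_succ N)) r).trans
          (pow_le_pow_right₀ hM1 hrN.le)
      calc ∑ u ∈ terminal w δ N S r, q * w u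
          = q * ∑ u ∈ terminal w δ N S r, w u := by rw [Finset.mul_sum]
        _ ≤ q * ∑ u ∈ fat w δ N S r, w u := mul_le_mul_of_nonneg_left h1 hq0
        _ ≤ K * δ ^ (2 ^ r - 1) * ∑ u ∈ fat w δ N S r, w u := mul_le_mul_of_nonneg_right hq' h2
        _ = K * (δ ^ (2 ^ r - 1) * ∑ u ∈ fat w δ N S r, w u) := by ring
        _ ≤ K * (M ^ N * G) := by
            refine mul_le_mul_of_nonneg_left (h3.trans ?_) hK0.le
            exact mul_le_mul_of_nonneg_right h4 hG0
    refine (Finset.sum_le_sum this).trans ?_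
    rw [Finset.sum_const, nsmul_eq_mul, Finset.card_range]
  have hmain : ε * (G - N * (K * (M ^ N * G))) ≤
      N * (M * (N * (2 * δ * M ^ (N + 3)) * G)) := by
    refine le_trans ?_ hupper
    calc ε * (G - N * (K * (M ^ N * G)))
        ≤ ε * (∑ r ∈ Finset.range N, ∑ u ∈ terminal w δ N S r, wnorm w (H r u) -
            ∑ r ∈ Finset.range N, ∑ u ∈ terminal w δ N S r, q * w u) :=
          mul_le_mul_of_nonneg_left (sub_le_sub hcover hqsum) hε.le
      _ = ∑ r ∈ Finset.range N, ∑ u ∈ terminal w δ N S r,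
            ε * (wnorm w (H r u) - q * w u) := by
          simp only [Finset.mul_sum, Finset.sum_sub_distrib, mul_sub]
      _ ≤ _ := Finset.sum_le_sum fun r hr => Finset.sum_le_sum fun u hu =>
          hloc r (Finset.mem_range.1 hr) u hu
  have hN : (N : ℝ) ≤ M := by
    have h1 : N ≤ 2 ^ (N + 1) := (Nat.lt_two_pow_self (n := N)).le.trans
      (Nat.pow_le_pow_right (by norm_num) (Nat.le_succ N))
    rw [hM]
    exact_mod_cast h1
  -- The exponent is N + 3 from `weight_bad_le`, one for the faces u below a bad face, and two for
  -- the factors N. The error terms become G/4 and G/2, together less than G.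
  have hKM : K * M ^ (N + 6) ≤ 1 / 4 := by linarith
  have hA : N * (K * (M ^ N * G)) ≤ 1 / 4 * G := by
    have : M * (K * M ^ N) ≤ K * M ^ (N + 6) := by
      calc M * (K * M ^ N) = K * M ^ (N + 1) := by ring
        _ ≤ K * M ^ (N + 6) :=
          mul_le_mul_of_nonneg_left (pow_le_pow_right₀ hM1 (by omega)) hK0.le
    calc N * (K * (M ^ N * G)) ≤ M * (K * (M ^ N * G)) :=
          mul_le_mul_of_nonneg_right hN (by positivity)
      _ = M * (K * M ^ N) * G := by ring
      _ ≤ 1 / 4 * G := mul_le_mul_of_nonneg_right (this.trans hKM) hG0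
  have hB : N * (M * (N * (2 * δ * M ^ (N + 3)) * G)) ≤ ε * (1 / 2 * G) := by
    calc N * (M * (N * (2 * δ * M ^ (N + 3)) * G))
        ≤ M * (M * (M * (2 * δ * M ^ (N + 3)) * G)) := by gcongr
      _ = 2 * ε * G * (K * M ^ (N + 6)) := by rw [hδdef]; ring
      _ ≤ 2 * ε * G * (1 / 4) := mul_le_mul_of_nonneg_left hKM (by positivity)
      _ = ε * (1 / 2 * G) := by ring
  have hfin : ε * (G - N * (K * (M ^ N * G))) ≤ ε * (1 / 2 * G) := hmain.trans hB
  have hfin' := le_of_mul_le_mul_left hfin hε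
  exact eq_zero_of_wnorm_eq_zero hw.pos (le_antisymm (by linarith) hG0)

end Faces

/-! ### The cochain complex and termination of the algorithm -/

section Complex

variable {R : Type u} [CommRing R] {P : Type v} [PartialOrder P] [GradeOrder ℤ P] [Fintype P]
  {F : PosetSheaf.{u, v, t} R P} {w : P → ℝ} {i j l : ℤ}

/-- Collecting terms by x makes the orientation sum between x and z the coefficient of the
restriction from x to z. -/
theorem coboundary_coboundary (o : Orientation R P) (hj : j = i + 1) (hl : l = j + 1)
    (f : Cochain F i) : coboundary o F j l (coboundary o F i j f) = 0 := by
  classical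
  funext z
  have h1 : ∀ y : Cells P j,
      (if h : y.1 ≤ z.1 then (o.sgn z.1 y.1 : R) • F.res h (coboundary o F i j f y) else 0) =
      ∑ x : Cells P i, if h : x.1 ≤ z.1 then
        (if x.1 ≤ y.1 ∧ y.1 ≤ z.1 then (o.sgn z.1 y.1 : R) * (o.sgn y.1 x.1 : R) else 0) •
          F.res h (f x) else 0 := by
    intro y
    by_cases hy : y.1 ≤ z.1
    · rw [dif_pos hy]
      have h2 : coboundary o F i j f y = ∑ x : Cells P i,
          if h : x.1 ≤ y.1 then (o.sgn y.1 x.1 : R) • F.res h (f x) else 0 := rfl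
      rw [h2, map_sum, Finset.smul_sum]
      refine Finset.sum_congr rfl fun x _ => ?_
      by_cases hx : x.1 ≤ y.1
      · rw [dif_pos hx, dif_pos (hx.trans hy), if_pos ⟨hx, hy⟩, map_smul, smul_smul,
          ← F.res_comp hx hy]
        rfl
      · rw [dif_neg hx, map_zero, smul_zero, if_neg fun h => hx h.1]
        split_ifs <;> simp
    · rw [dif_neg hy]
      symm
      refine Finset.sum_eq_zero fun x _ => ?_
      rw [if_neg fun h => hy h.2]
      split_ifs <;> simp
  have h3 : coboundary o F j l (coboundary o F i j f) z = ∑ y : Cells P j,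
      if h : y.1 ≤ z.1 then (o.sgn z.1 y.1 : R) • F.res h (coboundary o F i j f y) else 0 := rfl
  rw [h3, Finset.sum_congr rfl fun y _ => h1 y, Finset.sum_comm]
  refine Finset.sum_eq_zero fun x _ => ?_
  by_cases hxz : x.1 ≤ z.1
  · simp only [dif_pos hxz]
    rw [← Finset.sum_smul]
    have h4 : ∑ y : Cells P j,
        (if x.1 ≤ y.1 ∧ y.1 ≤ z.1 then (o.sgn z.1 y.1 : R) * (o.sgn y.1 x.1 : R) else 0) = 0 := by
      rw [← Finset.sum_filter, ← o.sum_eq_zero x.1 z.1 hxz (by rw [x.2, z.2]; omega)]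
      refine Finset.sum_bij (fun y _ => y.1) ?_ ?_ ?_ ?_
      · intro y hy
        simp only [Finset.mem_filter, Finset.mem_univ, true_and] at hy ⊢
        have hx := x.2
        have hy2 := y.2
        have hz := z.2
        refine ⟨lt_of_le_of_ne hy.1 fun h => ?_, lt_of_le_of_ne hy.2 fun h => ?_⟩
        · rw [h] at hx
          omega
        · rw [h] at hy2
          omega
      · intro a _ b _ h
        exact Subtype.ext h
      · intro y hy
        simp only [Finset.mem_filter, Finset.mem_univ, true_and] at hy
        have h5 : dim x.1 < dim y := grade_strictMono (𝕆 := ℤ) hy.1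
        have h6 : dim y < dim z.1 := grade_strictMono (𝕆 := ℤ) hy.2
        have hx := x.2
        have hz := z.2
        refine ⟨⟨y, by omega⟩, ?_, rfl⟩
        simp only [Finset.mem_filter, Finset.mem_univ, true_and]
        exact ⟨hy.1.le, hy.2.le⟩
      · intro _ _
        rfl
    rw [h4, zero_smul]
  · simp only [dif_neg hxz, Finset.sum_const_zero]

theorem coboundaries_le_cocycles (o : Orientation R P) (F : PosetSheaf.{u, v, t} R P) (i : ℤ) :
    coboundaries o F i ≤ cocycles o F i := by
  rintro _ ⟨g, rfl⟩
  exact coboundary_coboundary o (by omega) rfl g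

theorem IsSkeletonExpander.mono (hw : ∀ x, 0 ≤ w x) {α α' β : ℝ} (hα : α ≤ α')
    (h : IsSkeletonExpander w α β) : IsSkeletonExpander w α' β := by
  intro A
  refine (h A).trans ?_
  have : 0 ≤ ∑ a ∈ A, w a.1 := Finset.sum_nonneg fun a _ => hw a.1
  gcongr

theorem CorrectionStep.wnorm_lt (hw : ∀ x, 0 ≤ w x) {o : Orientation R P} {q : ℝ} (hq : 0 ≤ q)
    {f f' : Cochain F i} (h : CorrectionStep o w F i q f f') :
    wnorm w (coboundary o F i (i + 1) f') < wnorm w (coboundary o F i (i + 1) f) := by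
  obtain ⟨u, -, -, g, hlt, rfl⟩ := h
  rw [map_add]
  have := mul_nonneg hq (hw u)
  linarith

theorem correctionStops (hw : ∀ x, 0 ≤ w x) (o : Orientation R P) {q : ℝ} (hq : 0 ≤ q)
    (f : Cochain F i) : CorrectionStops o w F i q f := by
  rintro ⟨s, -, hs⟩
  have hanti : StrictAnti fun n => wnorm w (coboundary o F i (i + 1) (s n)) :=
    strictAnti_nat_of_succ_lt fun n => (hs n).wnorm_lt hw hq
  refine Set.infinite_range_of_injective hanti.injective
    ((finite_range_wnorm w F (i + 1)).subset ?_)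
  rintro _ ⟨n, rfl⟩
  exact ⟨_, rfl⟩

theorem CorrectionStops.exists_returns {o : Orientation R P} {q : ℝ} {f : Cochain F i}
    (h : CorrectionStops o w F i q f) : ∃ f', CorrectionReturns o w F i q f f' := by
  by_contra! hcon
  have hstep : ∀ a : {f' // Relation.ReflTransGen (CorrectionStep o w F i q) f f'},
      ∃ b : {f' // Relation.ReflTransGen (CorrectionStep o w F i q) f f'},
        CorrectionStep o w F i q a.1 b.1 := by
    intro a
    by_contra! hno
    exact hcon a.1 ⟨a.2, fun ⟨b, hb⟩ => hno ⟨b, a.2.tail hb⟩ hb⟩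
  choose φ hφ using hstep
  refine h ⟨fun n => (φ^[n] ⟨f, .refl⟩).1, rfl, fun n => ?_⟩
  simp only [Function.iterate_succ_apply']
  exact hφ _

end Complex

/-! ### From local minimality to cocycles -/

section LocalToGlobal

variable {R : Type u} [CommRing R] {V : Type v} {X : PreAbstractSimplicialComplex V}
  {F : PosetSheaf.{u, v, t} R (FacePoset X)} {i j : ℤ}

theorem extend_eq_zero_of_dim_le {u : FacePoset X} (hju : j < dim u)
    (h : Cochain (F.link u) (j - dim u - 1)) : extend F u j h = 0 := by
  funext x
  refine extend_apply_of_not_le fun hux => ?_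
  have h1 := face_card_le hux
  have h2 := x.2
  rw [dim_face] at h2 hju
  omega

variable [Fintype (FacePoset X)] {d : ℕ} {w : FacePoset X → ℝ}

theorem extend_mem_coboundaries {o : Orientation R (FacePoset X)} (hj : j = i - 1)
    {u : FacePoset X} {b : Cochain (F.link u) (i - dim u - 1)}
    (hb : b ∈ coboundaries (o.link u) (F.link u) (i - dim u - 1)) :
    ∃ h : Cochain (F.link u) (j - dim u - 1),
      extend F u i b = coboundary o F j i (extend F u j h) := by
  obtain ⟨h, rfl⟩ := mem_coboundaries (j := j - dim u - 1) (by omega) hb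
  exact ⟨h, (coboundary_extend o u j i h).symm⟩

/-- The estimate telescopes: a step at u lowers ‖df‖ by more than q w(u) and moves f by at most 2^n
w(u). -/
theorem CorrectionReturns.mul_wnorm_sub_le (hw : IsProperWeight d w)
    {o : Orientation R (FacePoset X)} {n : ℕ} (hn : i + 1 = n) (hnd : n ≤ d + 1) {q : ℝ}
    (hq : 0 ≤ q) {f f' : Cochain F i} (h : CorrectionReturns o w F i q f f') :
    q * wnorm w (f - f') ≤ 2 ^ n * wnorm w (coboundary o F i (i + 1) f) := by
  have hw0 : ∀ x, 0 ≤ w x := fun x => (hw.pos x).le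
  have key : q * wnorm w (f - f') ≤ 2 ^ n * (wnorm w (coboundary o F i (i + 1) f) -
      wnorm w (coboundary o F i (i + 1) f')) := by
    obtain ⟨h, -⟩ := h
    induction h with
    | refl => simp [wnorm]
    | @tail a _ _ hstep ih =>
      obtain ⟨u, -, hu, g, hlt, rfl⟩ := hstep
      have hc : u.1.card ≤ n := by
        rw [dim_face] at hu
        omega
      have h1 := wnorm_extend_le hw hn hnd hc g
      have h2 := wnorm_sub_le hw0 (f - a) (extend F u i g)
      rw [← map_add] at hlt
      rw [← sub_sub]
      have h3 := mul_le_mul_of_nonneg_left (h2.trans (add_le_add_right h1 _)) hq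
      have h4 := mul_le_mul_of_nonneg_left hlt.le (show (0 : ℝ) ≤ 2 ^ n by positivity)
      linarith
  have h0 := wnorm_nonneg hw0 (coboundary o F i (i + 1) f')
  have := mul_nonneg (show (0 : ℝ) ≤ 2 ^ n by positivity) h0
  linarith

theorem CorrectionReturns.mem_cocycles (hw : IsProperWeight d w)
    {o : Orientation R (FacePoset X)} {N : ℕ} (hi : i + 2 = N) (hNd : N ≤ d) {K ε q : ℝ}
    (hK0 : 0 < K) (hK : 4 * (2 ^ (N + 1)) ^ (N + 6) * K ≤ 1) (hε : 0 < ε) (hε1 : ε ≤ 1)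
    (hq0 : 0 ≤ q) (hq : q ≤ K * (K * ε) ^ (2 ^ (N - 1) - 1))
    (hcbe : ∀ u : FacePoset X, 0 ≤ dim u → dim u ≤ i + 1 →
      (ε : EReal) ≤ cbe (o.link u) (linkWeight d w u) (F.link u) (i - dim u))
    (hexp : ∀ r < N, ∀ z : FacePoset X, z.1.card + (r + 1) = N →
      IsSkeletonExpander (linkWeight d w z) ((K * ε) ^ 2 ^ r) 1)
    {f f' : Cochain F i} (h : CorrectionReturns o w F i q f f')
    (hsmall : (2 ^ N) ^ N * wnorm w (coboundary o F i (i + 1) f) < (K * ε) ^ (2 ^ N - 1)) :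
    f' ∈ cocycles o F i := by
  have hw0 : ∀ x, 0 ≤ w x := fun x => (hw.pos x).le
  have hle : wnorm w (coboundary o F i (i + 1) f') ≤ wnorm w (coboundary o F i (i + 1) f) := by
    obtain ⟨h, -⟩ := h
    induction h with
    | refl => exact le_rfl
    | tail _ hstep ih => exact (hstep.wnorm_lt hw0 hq0).le.trans ih
  refine eq_zero_of_locally_minimal hw (i := i + 1) (N := N) (by omega) hNd hK0 hK hε hε1 hq0 hq
    (fun u hu0 hu => ?_) hexp (coboundary_coboundary o rfl rfl f') (fun u hu0 hu b hb => ?_)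
    (lt_of_le_of_lt (mul_le_mul_of_nonneg_left hle (by positivity)) hsmall)
  · rw [show i + 1 - dim u - 1 = i - dim u by ring]
    exact hcbe u hu0 hu
  · obtain ⟨g, hg⟩ := extend_mem_coboundaries (j := i) (by omega) hb
    rw [hg]
    by_cases hui : dim u ≤ i
    · by_contra! hcon
      exact h.2 ⟨_, u, hu0, hui, g, hcon, rfl⟩
    -- For dim u = i + 1 the algorithm has no move at `u`, but none is needed: no i-face lies above
    -- `u`, so the correction is zero.
    · rw [extend_eq_zero_of_dim_le (not_le.1 hui), map_zero, add_zero]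
      have := mul_nonneg hq0 (hw0 u)
      linarith

/-- A lightest representative of the class of f is locally minimal with q = 0; if f were too light,
it would vanish and f would be a coboundary. -/
theorem le_wnorm_of_mem_cocycles (hw : IsProperWeight d w)
    {o : Orientation R (FacePoset X)} {N : ℕ} (hi : i + 1 = N) (hNd : N ≤ d) {K ε : ℝ}
    (hK0 : 0 < K) (hK : 4 * (2 ^ (N + 1)) ^ (N + 6) * K ≤ 1) (hε : 0 < ε) (hε1 : ε ≤ 1)
    (hcbe : ∀ u : FacePoset X, 0 ≤ dim u → dim u ≤ i →
      (ε : EReal) ≤ cbe (o.link u) (linkWeight d w u) (F.link u) (i - dim u - 1))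
    (hexp : ∀ r < N, ∀ z : FacePoset X, z.1.card + (r + 1) = N →
      IsSkeletonExpander (linkWeight d w z) ((K * ε) ^ 2 ^ r) 1)
    {f : Cochain F i} (hf : f ∈ cocycles o F i) (hfB : f ∉ coboundaries o F i) :
    (K * ε) ^ (2 ^ N - 1) ≤ (2 ^ N) ^ N * wnorm w f := by
  have hw0 : ∀ x, 0 ≤ w x := fun x => (hw.pos x).le
  by_contra! hsmall
  obtain ⟨_, ⟨b, rfl⟩, hmin⟩ := Set.exists_min_image
    (Set.range fun b : coboundaries o F i => wnorm w (f - b.1)) id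
    ((finite_range_wnorm w F i).subset (by rintro _ ⟨b, rfl⟩; exact ⟨_, rfl⟩))
    ⟨_, 0, rfl⟩
  have hmin' : ∀ c ∈ coboundaries o F i, wnorm w (f - b.1) ≤ wnorm w (f - c) :=
    fun c hc => hmin _ ⟨⟨c, hc⟩, rfl⟩
  have hle : wnorm w (f - b.1) ≤ wnorm w f := by
    simpa using hmin' 0 (Submodule.zero_mem _)
  have h0 : f - b.1 = 0 := by
    refine eq_zero_of_locally_minimal hw hi hNd hK0 hK hε hε1 le_rfl (by positivity) hcbe hexp
      (Submodule.sub_mem _ hf (coboundaries_le_cocycles o F i b.2)) (fun u _ _ c hc => ?_)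
      (lt_of_le_of_lt (mul_le_mul_of_nonneg_left hle (by positivity)) hsmall)
    obtain ⟨g, hg⟩ := extend_mem_coboundaries (j := i - 1) rfl hc
    have hB : extend F u i c ∈ coboundaries o F i := hg ▸ ⟨_, rfl⟩
    have := hmin' _ (Submodule.sub_mem _ b.2 hB)
    rw [zero_mul, sub_zero]
    rwa [← sub_add] at this
  exact hfB (sub_eq_zero.1 h0 ▸ b.2)

end LocalToGlobal

end SheafExpansion

/-! ### Choice of constants and assembly -/

open SheafExpansion in
theorem mainTheorem7 (k : ℕ) :
    ∃ K K' : ℝ, 0 < K ∧ K ≤ 1 ∧ 0 < K' ∧ K' ≤ 1 ∧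
      ∀ (R : Type u) [CommRing R] (V : Type v) (X : PreAbstractSimplicialComplex V)
        [Fintype (FacePoset X)] (d : ℕ) (_hd : k + 2 ≤ d)
        (w : FacePoset X → ℝ) (_hw : IsProperWeight d w)
        (o : Orientation R (FacePoset X)) (F : PosetSheaf.{u, v, t} R (FacePoset X))
        (ε : ℝ) (_hε0 : 0 < ε) (_hε1 : ε ≤ 1)
        (_h1a : ∀ x : FacePoset X, 0 ≤ dim x → dim x ≤ k →
          (ε : EReal) ≤ cbe (o.link x) (linkWeight d w x) (F.link x) (k - dim x - 1))
        (_h1b : ∀ x : FacePoset X, 0 ≤ dim x → dim x ≤ k + 1 →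
          (ε : EReal) ≤ cbe (o.link x) (linkWeight d w x) (F.link x) (k - dim x))
        (_h2 : ∀ x : FacePoset X, -1 ≤ dim x → dim x ≤ k →
          IsSkeletonExpander (linkWeight d w x)
            ((K * ε) ^ (2 ^ ((k : ℤ) - dim x).toNat)) 1),
        ((K' * (K * ε) ^ (2 ^ (k + 2) - 1) : ℝ) : EReal) ≤ cse o w F k ∧
        ((K' * (K * ε) ^ (2 ^ (k + 1) - 1) : ℝ) : EReal) ≤ ccd o w F k ∧
        ∀ f : Cochain F k,
          wdist w f (cocycles o F k) < K' * (K * ε) ^ (2 ^ (k + 2) - 1) →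
          CorrectionStops o w F k (K * (K * ε) ^ (2 ^ (k + 1) - 1)) f ∧
          ∀ f' : Cochain F k,
            CorrectionReturns o w F k (K * (K * ε) ^ (2 ^ (k + 1) - 1)) f f' →
            f' ∈ cocycles o F k ∧
            wnorm w (f - f') ≤
              K'⁻¹ * ((K * ε) ^ (2 ^ (k + 1)))⁻¹ * wdist w f (cocycles o F k) := by
  -- M is 2^(N + 1) for N = k + 2, the number of vertices of the faces carrying df, and K is the
  -- largest constant that the vanishing statement allows for this N. K' absorbs M^(k + 2) from the
  -- smallness condition and one M from ‖df‖ ≤ M dist(f, Z^k).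
  obtain ⟨M, hM⟩ : ∃ M : ℝ, M = 2 ^ (k + 3) := ⟨_, rfl⟩
  have hM1 : 1 ≤ M := hM ▸ one_le_pow₀ (by norm_num)
  have hM0 : 0 < M := by linarith
  obtain ⟨K, hKdef⟩ : ∃ K : ℝ, K = 1 / (4 * M ^ (k + 8)) := ⟨_, rfl⟩
  obtain ⟨K', hK'def⟩ : ∃ K' : ℝ, K' = K / M ^ (k + 3) := ⟨_, rfl⟩
  have hK0 : 0 < K := by rw [hKdef]; positivity
  have hKM : 4 * M ^ (k + 8) * K = 1 := by rw [hKdef]; field_simp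
  have hK1 : K ≤ 1 := by
    have : 1 ≤ M ^ (k + 8) := one_le_pow₀ hM1
    nlinarith
  have hK'0 : 0 < K' := by rw [hK'def]; positivity
  have hK'M : K' * M ^ (k + 3) = K := by rw [hK'def]; field_simp
  have hK'K : K' ≤ K := by
    rw [← hK'M]
    exact le_mul_of_one_le_right hK'0.le (one_le_pow₀ hM1)
  refine ⟨K, K', hK0, hK1, hK'0, hK'K.trans hK1, ?_⟩
  intro R _ V X _ d hd w hw o F ε hε0 hε1 h1a h1b h2
  have hw0 : ∀ x, 0 ≤ w x := fun x => (hw.pos x).le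
  obtain ⟨δ, hδdef⟩ : ∃ δ : ℝ, δ = K * ε := ⟨_, rfl⟩
  have hδ0 : 0 < δ := by rw [hδdef]; positivity
  have hδ1 : δ ≤ 1 := by rw [hδdef]; exact mul_le_one₀ hK1 hε0.le hε1
  have hexp : ∀ r < k + 2, ∀ z : FacePoset X, z.1.card + (r + 1) = k + 2 →
      IsSkeletonExpander (linkWeight d w z) ((K * ε) ^ 2 ^ r) 1 := by
    intro r hr z hz
    have h := h2 z (by rw [dim_face]; omega) (by rw [dim_face]; omega)
    rwa [show ((k : ℤ) - dim z).toNat = r by rw [dim_face]; omega] at h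
  have hexp' : ∀ r < k + 1, ∀ z : FacePoset X, z.1.card + (r + 1) = k + 1 →
      IsSkeletonExpander (linkWeight d w z) ((K * ε) ^ 2 ^ r) 1 := by
    intro r hr z hz
    -- With N = k + 1 the same face z has codimension index smaller by one, and δ ≤ 1 makes the
    -- given exponent 2^(r + 1) more than sufficient.
    refine (hexp (r + 1) (by omega) z (by omega)).mono (linkWeight_nonneg hw z) ?_
    rw [← hδdef]
    exact pow_le_pow_of_le_one hδ0.le hδ1 (Nat.pow_le_pow_right (by norm_num) (Nat.le_succ r))
  have hpow : ∀ a b : ℕ, a ≤ k + 3 → ((2 : ℝ) ^ a) ^ b ≤ M ^ b := by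
    intro a b ha
    rw [hM]
    exact pow_le_pow_left₀ (by positivity) (pow_le_pow_right₀ (by norm_num) ha) b
  have hKk : 4 * ((2 : ℝ) ^ (k + 1 + 1)) ^ (k + 1 + 6) * K ≤ 1 := by
    rw [← hKM]
    refine mul_le_mul_of_nonneg_right (mul_le_mul_of_nonneg_left ?_ (by norm_num)) hK0.le
    exact (hpow _ _ (by omega)).trans (pow_le_pow_right₀ hM1 (by omega))
  have hKk' : 4 * ((2 : ℝ) ^ (k + 2 + 1)) ^ (k + 2 + 6) * K ≤ 1 := by
    rw [← hKM]
    refine mul_le_mul_of_nonneg_right (mul_le_mul_of_nonneg_left ?_ (by norm_num)) hK0.le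
    exact hpow _ _ (by omega)
  obtain ⟨q, hqdef⟩ : ∃ q : ℝ, q = K * δ ^ (2 ^ (k + 1) - 1) := ⟨_, rfl⟩
  have hq0 : 0 < q := by rw [hqdef]; positivity
  rw [← hδdef, ← hqdef]
  have hterm : ∀ f : Cochain F k, CorrectionStops o w F k q f := correctionStops hw0 o hq0.le
  have hret : ∀ f f' : Cochain F k, CorrectionReturns o w F k q f f' →
      q * wnorm w (f - f') ≤ M * wnorm w (coboundary o F k (k + 1) f) := by
    intro f f' h
    refine (h.mul_wnorm_sub_le hw (n := k + 1) (by push_cast; rfl) (by omega) hq0.le).trans ?_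
    refine mul_le_mul_of_nonneg_right ?_ (wnorm_nonneg hw0 _)
    rw [hM]
    exact pow_le_pow_right₀ (by norm_num) (by omega)
  have hcoc : ∀ f f' : Cochain F k, CorrectionReturns o w F k q f f' →
      M ^ (k + 2) * wnorm w (coboundary o F k (k + 1) f) < δ ^ (2 ^ (k + 2) - 1) →
      f' ∈ cocycles o F k := by
    intro f f' h hs
    refine h.mem_cocycles hw (N := k + 2) (by push_cast; rfl) hd hK0 hKk' hε0 hε1 hq0.le
      (by rw [hqdef, hδdef]; rfl) h1b hexp ?_
    rw [← hδdef]
    refine lt_of_le_of_lt (mul_le_mul_of_nonneg_right ?_ (wnorm_nonneg hw0 _)) hs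
    exact hpow _ _ (by omega)
  have hMK' : ∀ n ≤ k + 3, K' * M ^ n ≤ K := by
    intro n hn
    rw [← hK'M]
    exact mul_le_mul_of_nonneg_left (pow_le_pow_right₀ hM1 hn) hK'0.le
  refine ⟨?_, ?_, ?_⟩
  · refine le_sSup ⟨_, ⟨by positivity, fun f => ?_⟩, rfl⟩
    have hn0 := wnorm_nonneg hw0 (coboundary o F k (k + 1) f)
    have hp0 : 0 < δ ^ (2 ^ (k + 2) - 1) := by positivity
    -- If df is small, the algorithm yields a nearby cocycle; otherwise it suffices that distances
    -- are at most 1.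
    by_cases hs : M ^ (k + 2) * wnorm w (coboundary o F k (k + 1) f) < δ ^ (2 ^ (k + 2) - 1)
    · obtain ⟨f', hf'⟩ := (hterm f).exists_returns
      have hd1 := wdist_le hw0 f _ (hcoc f f' hf' hs)
      have hd2 := hret f f' hf'
      have hle : δ ^ (2 ^ (k + 2) - 1) ≤ δ ^ (2 ^ (k + 1) - 1) :=
        pow_le_pow_of_le_one hδ0.le hδ1
          (Nat.sub_le_sub_right (Nat.pow_le_pow_right (by norm_num) (by omega)) 1)
      have hnf := wnorm_nonneg hw0 (f - f')
      have hK'1 := hMK' 1 (by omega)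
      have hD0 : 0 ≤ wdist w f (cocycles o F k) := le_wdist _ _ fun g _ => wnorm_nonneg hw0 _
      refine le_of_mul_le_mul_left ?_ hM0
      calc M * (K' * δ ^ (2 ^ (k + 2) - 1) * wdist w f (cocycles o F k))
          ≤ M * (K' * δ ^ (2 ^ (k + 1) - 1) * wnorm w (f - f')) := by gcongr
        _ = (K' * M ^ 1) * (δ ^ (2 ^ (k + 1) - 1) * wnorm w (f - f')) := by ring
        _ ≤ K * (δ ^ (2 ^ (k + 1) - 1) * wnorm w (f - f')) := by gcongr
        _ = q * wnorm w (f - f') := by rw [hqdef]; ring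
        _ ≤ _ := hd2
    · have hd1 := wdist_le hw0 f (cocycles o F k) (Submodule.zero_mem _)
      rw [sub_zero] at hd1
      have hd2 := hd1.trans (wnorm_le_one hw (n := k + 1) (by push_cast; rfl) (by omega) f)
      have hK'2 := (hMK' (k + 2) (by omega)).trans hK1
      calc K' * δ ^ (2 ^ (k + 2) - 1) * wdist w f (cocycles o F k)
          ≤ K' * δ ^ (2 ^ (k + 2) - 1) * 1 := by gcongr
        _ ≤ K' * (M ^ (k + 2) * wnorm w (coboundary o F k (k + 1) f)) := by
            rw [mul_one]
            exact mul_le_mul_of_nonneg_left (not_lt.1 hs) hK'0.le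
        _ = K' * M ^ (k + 2) * wnorm w (coboundary o F k (k + 1) f) := by ring
        _ ≤ 1 * wnorm w (coboundary o F k (k + 1) f) := by gcongr
        _ = _ := one_mul _
  · refine le_sInf ?_
    rintro _ ⟨f, ⟨hf, hfB⟩, rfl⟩
    refine EReal.coe_le_coe_iff.2 ?_
    have h := le_wnorm_of_mem_cocycles hw (N := k + 1) (by push_cast; rfl) (by omega) hK0 hKk
      hε0 hε1 h1a hexp' hf hfB
    rw [← hδdef] at h
    have hn0 := wnorm_nonneg hw0 f
    have hK'1 := (hMK' (k + 1) (by omega)).trans hK1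
    calc K' * δ ^ (2 ^ (k + 1) - 1)
        ≤ K' * ((2 ^ (k + 1)) ^ (k + 1) * wnorm w f) := mul_le_mul_of_nonneg_left h hK'0.le
      _ ≤ K' * (M ^ (k + 1) * wnorm w f) := by
          refine mul_le_mul_of_nonneg_left (mul_le_mul_of_nonneg_right ?_ hn0) hK'0.le
          exact hpow _ _ (by omega)
      _ = K' * M ^ (k + 1) * wnorm w f := by ring
      _ ≤ 1 * wnorm w f := by gcongr
      _ = _ := one_mul _
  · intro f hf
    refine ⟨hterm f, fun f' hf' => ?_⟩
    set D := wdist w f (cocycles o F k) with hD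
    have hD0 : 0 ≤ D := le_wdist _ _ fun g _ => wnorm_nonneg hw0 _
    have hk : ((k + 1 : ℕ) : ℝ) + 1 ≤ M := by
      have h3 : k + 3 < 2 ^ (k + 3) := Nat.lt_two_pow_self
      have h4 : ((k + 3 : ℕ) : ℝ) ≤ M := by rw [hM]; exact_mod_cast h3.le
      push_cast at h4 ⊢
      linarith
    have hdf : wnorm w (coboundary o F k (k + 1) f) ≤ M * D := by
      rw [mul_comm, ← div_le_iff₀ hM0]
      refine le_wdist _ _ fun g hg => ?_
      rw [div_le_iff₀ hM0, mul_comm]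
      have hg' : coboundary o F k (k + 1) g = 0 := hg
      have h := wnorm_coboundary_le hw o (n := k + 1) (by push_cast; rfl) (by omega) (f - g)
      rw [map_sub, hg', sub_zero] at h
      exact h.trans (mul_le_mul_of_nonneg_right hk (wnorm_nonneg hw0 _))
    have hp0 : 0 < δ ^ (2 ^ (k + 2) - 1) := by positivity
    refine ⟨hcoc f f' hf' ?_, ?_⟩
    · calc M ^ (k + 2) * wnorm w (coboundary o F k (k + 1) f)
          ≤ M ^ (k + 2) * (M * D) := by gcongr
        _ = M ^ (k + 3) * D := by ring
        _ < M ^ (k + 3) * (K' * δ ^ (2 ^ (k + 2) - 1)) := by gcongr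
        _ = K * δ ^ (2 ^ (k + 2) - 1) := by rw [← hK'M]; ring
        _ ≤ 1 * δ ^ (2 ^ (k + 2) - 1) := by gcongr
        _ = _ := one_mul _
    · have hle : δ ^ (2 ^ (k + 1)) ≤ δ ^ (2 ^ (k + 1) - 1) :=
        pow_le_pow_of_le_one hδ0.le hδ1 (Nat.sub_le _ 1)
      have hnf := wnorm_nonneg hw0 (f - f')
      have hK'2 := hMK' 2 (by omega)
      rw [← mul_inv, ← div_eq_inv_mul, le_div_iff₀ (by positivity)]
      refine le_of_mul_le_mul_left ?_ (show 0 < M ^ 2 by positivity)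
      calc M ^ 2 * (wnorm w (f - f') * (K' * δ ^ (2 ^ (k + 1))))
          = K' * M ^ 2 * δ ^ (2 ^ (k + 1)) * wnorm w (f - f') := by ring
        _ ≤ K * δ ^ (2 ^ (k + 1) - 1) * wnorm w (f - f') := by gcongr
        _ = q * wnorm w (f - f') := by rw [hqdef]
        _ ≤ M * wnorm w (coboundary o F k (k + 1) f) := hret f f' hf'
        _ ≤ M * (M * D) := by gcongr
        _ = M ^ 2 * D := by ring
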